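/- **Setting.** Let $\Omega_f,\Omega_p\subset\mathbb R^2$ be disjoint bounded connected open sets with Lipschitz boundary, $\Gamma=\partial\Omega_f\cap\partial\Omega_p$, $\Gamma_f=\partial\Omega_f\setminus\Gamma\neq\emptyset$, $\Gamma_p=\partial\Omega_p\setminus\Gamma\ne\emptyset$; let $\mathbf n_f$ be the unit normal on $\Gamma$ pointing out of $\Omega_f$ and $\tau$ a unit tangent on $\Gamma$. Let $\nu,g,S>0$, $\alpha_{BJ}\ge 0$, and let $\mathrm K_1,\dots,\mathrm K_J$ be measurable fields of symmetric $2\times2$ matrices on $\Omega_p\cup\Gamma$, each bounded and uniformly positive definite. Put $\overline{\mathrm K}=\frac1J\sum_j\mathrm K_j$, $\eta_j=\alpha_{BJ}\,\nu\sqrt2/\sqrt{\tau\cdot\mathrm K_j\tau}$, $\overline\eta=\frac1J\sum_j\eta_j$. Let $X_f=\{\mathbf v\in H^1(\Omega_f)^2:\mathbf v|_{\Gamma_f}=0\}$, $X_p=\{\psi\in H^1(\Omega_p):\psi|_{\Gamma_p}=0\}$, $Q_f=L^2(\Omega_f)$; $(\cdot,\cdot)$ and $\|\cdot\|$ are the $L^2$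 inner product and norm on $\Omega_f$ or $\Omega_p$, and $(\cdot,\cdot)_\Gamma$, $\|\cdot\|_\Gamma$ those on $\Gamma$. Let $a(\mathbf u,\mathbf v)=\nu(\nabla\mathbf u,\nabla\mathbf v)$, $b(\mathbf v,p)=(\nabla\cdot\mathbf v,p)$, $d(\mathbf u,\mathbf v,\mathbf w)=((\mathbf u\cdot\nabla)\mathbf v,\mathbf w)-\frac12\int_\Gamma(\mathbf u\cdot\mathbf v)(\mathbf w\cdot\mathbf n_f)\,ds$ and $E(\mathbf u,\phi)=\frac12\|\mathbf u\|^2+\frac12gS\|\phi\|^2$. **Operators.** For $k\in\{2,3,4\}$, $\beta>1$ and a sequence $w$, let - $k=2$: $\alpha_2^\beta=\frac{2\beta+1}2$, $\overline A_2^\beta(w^n)=-2\beta w^n+\frac{2\beta-1}2w^{n-1}$, $B_2^\beta(w^n)=\beta w^n-(\beta-1)w^{n-1}$, $C_2^\beta(w^n)=(\beta+1)w^n-\beta w^{n-1}$; - $k=3$: $\alpha_3^\beta=\frac{3\beta^2+6\beta+2}6$, $\overline A_3^\beta(w^n)=-\frac{9\beta^2+12\beta-3}6w^n+\frac{9\beta^2+6\beta-6}6w^{n-1}-\frac{3\beta^2-1}6w^{n-2}$,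 $B_3^\beta(w^n)=\frac{\beta^2+\beta}2w^n-(\beta^2-1)w^{n-1}+\frac{\beta^2-\beta}2w^{n-2}$, $C_3^\beta(w^n)=\frac{\beta^2+3\beta+2}2w^n-(\beta^2+2\beta)w^{n-1}+\frac{\beta^2+\beta}2w^{n-2}$; - $k=4$: $\alpha_4^\beta=\frac{2\beta^3+9\beta^2+11\beta+3}{12}$, $\overline A_4^\beta(w^n)=\frac{-8\beta^3-30\beta^2-20\beta+10}{12}w^n+\frac{12\beta^3+36\beta^2+6\beta-18}{12}w^{n-1}+\frac{-8\beta^3-18\beta^2+4\beta+6}{12}w^{n-2}+\frac{2\beta^3+3\beta^2-\beta-1}{12}w^{n-3}$, $B_4^\beta(w^n)=\frac{\beta^3+3\beta^2+2\beta}6w^n+\frac{-\beta^3-2\beta^2+\beta+2}2w^{n-1}+\frac{\beta^3+\beta^2-2\beta}2w^{n-2}+\frac{-\beta^3+\beta}6w^{n-3}$, $C_4^\beta(w^n)=\frac{\beta^3+6\beta^2+11\beta+6}6w^n+\frac{-\beta^3-5\beta^2-6\beta}2w^{n-1}+\frac{\beta^3+4\beta^2+3\beta}2w^{n-2}+\frac{-\beta^3-3\beta^2-2\beta}6w^{n-3}$.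 **Scheme.** Given forcing terms $\mathbf f_{f,j}(t)\in L^2(\Omega_f)^2$, $f_{p,j}(t)\in L^2(\Omega_p)$ for $t\ge0$, constants $C_{r,j}$, $\alpha_j$, $\gamma_j$, a step $\Delta t>0$ and a final time $T$, write $\mathbf f_{f,j}^{s}=\mathbf f_{f,j}(s\Delta t)$, $f_{p,j}^{s}=f_{p,j}(s\Delta t)$. A solution of the $k$-step scheme consists of arbitrary starting values at the levels $0,\dots,k-1$ ($\overline{\mathbf u}_j^m,\mathbf u_j^m\in X_f$, $p_j^m\in Q_f$, $\overline\phi_j^m,\phi_j^m\in X_p$, $r_j^m\in\mathbb R$) and, for each $n$ with $k\le n+1\le T/\Delta t$ and each $j=1,\dots,J$, of $\overline{\mathbf u}_j^{n+1},\mathbf u_j^{n+1}\in X_f$, $p_j^{n+1}\in Q_f$, $\overline\phi_j^{n+1},\phi_j^{n+1}\in X_p$, $r_j^{n+1},\xi_j^{n+1}\in\mathbb R$ such that for all $\mathbf v\in X_f$, $q\in Q_f$, $\psi\in X_p$ $$\begin{aligned}&\Big(\tfrac{\alpha_k^\beta\overline{\mathbf u}_j^{n+1}+\overline A_k^\beta(\mathbf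 u_j^n)}{\Delta t},\mathbf v\Big)+\big(\overline\eta\,B_k^\beta(\overline{\mathbf u}_j^{n+1})\cdot\tau,\mathbf v\cdot\tau\big)_\Gamma+\big((\eta_j-\overline\eta)\,C_k^\beta(\overline{\mathbf u}_j^n)\cdot\tau,\mathbf v\cdot\tau\big)_\Gamma+a(B_k^\beta(\overline{\mathbf u}_j^{n+1}),\mathbf v)\\&\quad+d(C_k^\beta(\overline{\mathbf u}_j^n),C_k^\beta(\overline{\mathbf u}_j^n),\mathbf v)-b(\mathbf v,B_k^\beta(p_j^{n+1}))+(g\,C_k^\beta(\overline\phi_j^n),\mathbf v\cdot\mathbf n_f)_\Gamma=(\mathbf f_{f,j}^{n+\beta},\mathbf v),\qquad b(B_k^\beta(\overline{\mathbf u}_j^{n+1}),q)=0,\end{aligned}$$ $$\begin{aligned}&gS\Big(\tfrac{\alpha_k^\beta\overline\phi_j^{n+1}+\overline A_k^\beta(\phi_j^n)}{\Delta t},\psi\Big)+g\big(\overline{\mathrm K}\nabla B_k^\beta(\overline\phi_j^{n+1}),\nabla\psi\big)+g\big((\mathrm K_j-\overline{\mathrm K})\nabla C_k^\beta(\overline\phi_j^n),\nabla\psi\big)\\&\quad-(g\psi,C_k^\beta(\overline{\mathbf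 u}_j^n)\cdot\mathbf n_f)_\Gamma=g(f_{p,j}^{n+\beta},\psi),\end{aligned}$$ $$\begin{aligned}\frac{r_j^{n+1}-r_j^n}{\Delta t}+\gamma_jr_j^{n+1}=&-\frac{r_j^{n+1}}{E(\overline{\mathbf u}_j^{n+1},\overline\phi_j^{n+1})+C_{r,j}}\Big\{\nu\|\nabla\overline{\mathbf u}_j^{n+1}\|^2+g\|\sqrt{\mathrm K_j}\nabla\overline\phi_j^{n+1}\|^2+\|\sqrt{\eta_j}\,\overline{\mathbf u}_j^{n+1}\cdot\tau\|_\Gamma^2\\&\quad-(\mathbf f_{f,j}^{n+1},\overline{\mathbf u}_j^{n+1})-(gf_{p,j}^{n+1},\overline\phi_j^{n+1})+\tfrac{\alpha_j}2\big(\|\mathbf f_{f,j}^{n+1}\|^2+\|gf_{p,j}^{n+1}\|^2\big)\\&\quad-\tfrac{\gamma_j}2\big(\|\overline{\mathbf u}_j^{n+1}\|^2+gS\|\overline\phi_j^{n+1}\|^2\big)\Big\}+\tfrac{\alpha_j}2\big(\|\mathbf f_{f,j}^{n+1}\|^2+\|gf_{p,j}^{n+1}\|^2\big)+\gamma_jC_{r,j},\end{aligned}$$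 $$\xi_j^{n+1}=\frac{r_j^{n+1}}{E(\overline{\mathbf u}_j^{n+1},\overline\phi_j^{n+1})+C_{r,j}},\quad\mathbf u_j^{n+1}=\eta_{k,j}^{n+1}\overline{\mathbf u}_j^{n+1},\quad\phi_j^{n+1}=\eta_{k,j}^{n+1}\overline\phi_j^{n+1},\quad\eta_{k,j}^{n+1}=1-(1-\xi_j^{n+1})^{k+1}.$$ **Theorem.** There are constants $\alpha_j,\gamma_j>0$ $(j=1,\dots,J)$, depending only on $\Omega_f,\Omega_p,\mathbf n_f,\tau,\nu,g,S,\alpha_{BJ},\mathrm K_1,\dots,\mathrm K_J$, such that the following holds for each $k\in\{2,3,4\}$, $C_f>0$, $C_{r,j}\ge1$ and $R\in\mathbb R$. There is a constant $M_k>0$, depending only on these data, such that for all $\beta>1$, all $\Delta t>0$, all $T$, all forcing terms with $\|\mathbf f_{f,j}(t)\|,\|f_{p,j}(t)\|\le C_f$ for all $t\ge0$ and all $j$, every solution of the scheme with the constants $\alpha_j,\gamma_j,C_{r,j}$, every $j$ and every $n$ with $k\le n+1\le T/\Delta t$: 1. if $r_j^n>0$, then $r_j^{n+1}>0$ and $\xi_j^{n+1}>0$;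 2. if $0<r_j^{k-1}\le R$, then $r_j^{n+1}>0$, $\xi_j^{n+1}>0$ and $\|\mathbf u_j^{n+1}\|\le M_k$, $\|\phi_j^{n+1}\|\le M_k$. In particular $M_k$ depends neither on $T$ nor on $\Delta t$, and there is no restriction on $\Delta t$. -/

import Mathlib

open MeasureTheory Filter Topology Matrix
open scoped ContDiff

namespace NSD

/-! ## The plane, Sobolev functions, traces, Lipschitz domains -/

abbrev Plane : Type := EuclideanSpace ℝ (Fin 2)

/-- The `i`-th standard basis vector. -/
noncomputable def basisVec (i : Fin 2) : Plane := EuclideanSpace.single i 1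

/-- A bounded, connected open set which near each of its boundary points lies, after a linear
isometry, strictly above the graph of a Lipschitz function. -/
structure IsLipschitzDomain (Ω : Set Plane) : Prop where
  isOpen : IsOpen Ω
  isBounded : Bornology.IsBounded Ω
  isConnected : IsConnected Ω
  graph : ∀ x ∈ frontier Ω, ∃ (e : Plane ≃ₗᵢ[ℝ] Plane) (L : NNReal) (h : ℝ → ℝ) (ρ : ℝ),
    0 < ρ ∧ LipschitzWith L h ∧ ∀ y ∈ Metric.ball x ρ, (y ∈ Ω ↔ h (e y 0) < e y 1)

/-- `n` is the outward unit normal of `Ω` at the boundary point `x`: near `x`, every cone around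
`-n` of opening angle less than `π / 2` lies in `Ω`, and every such cone around `n` lies outside.
For a Lipschitz domain it exists at almost every boundary point, and it is unique. -/
def IsOuterNormal (Ω : Set Plane) (x n : Plane) : Prop :=
  ‖n‖ = 1 ∧ ∀ ε : ℝ, 0 < ε → ∀ᶠ y in 𝓝 x,
    (inner ℝ (y - x) n < -ε * ‖y - x‖ → y ∈ Ω) ∧
    (ε * ‖y - x‖ < inner ℝ (y - x) n → y ∉ Ω)

section Sobolev

variable {F : Type*} [NormedAddCommGroup F] [InnerProductSpace ℝ F]

/-- `G` is a square integrable weak gradient of `u` on `Ω`; `G x v` is the weak derivative at `x`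
in the direction `v`. -/
def IsWeakGrad (Ω : Set Plane) (u : Plane → F) (G : Plane → Plane →L[ℝ] F) : Prop :=
  MemLp G 2 (volume.restrict Ω) ∧
  ∀ θ : Plane → ℝ, ContDiff ℝ ∞ θ → HasCompactSupport θ → tsupport θ ⊆ Ω → ∀ v : Plane,
    ∫ x in Ω, (fderiv ℝ θ x v) • u x = - ∫ x in Ω, θ x • G x v

/-- Membership in `H¹(Ω; F)`. -/
def MemH1 (Ω : Set Plane) (u : Plane → F) : Prop :=
  MemLp u 2 (volume.restrict Ω) ∧ ∃ G, IsWeakGrad Ω u G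

open Classical in
/-- The weak gradient of a function in `H¹(Ω; F)` (unique almost everywhere on `Ω`). -/
noncomputable def weakGrad (Ω : Set Plane) (u : Plane → F) : Plane → Plane →L[ℝ] F :=
  if h : ∃ G, IsWeakGrad Ω u G then h.choose else 0

/-- `h` is the `L²` trace of `u ∈ H¹(Ω; F)` on the boundary piece `s`: some functions that are
smooth up to the boundary converge to `u` in `H¹(Ω; F)` while their restrictions to `s` converge
to `h` in `L²(s; F)`, where `s` carries the arc length. -/
def HasTrace (Ω s : Set Plane) (u h : Plane → F) : Prop :=
  MemLp h 2 ((μH[1] : Measure Plane).restrict s) ∧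
  ∃ w : ℕ → Plane → F, (∀ m, ContDiff ℝ ∞ (w m)) ∧
    Tendsto (fun m => eLpNorm (fun x => w m x - u x) 2 (volume.restrict Ω)) atTop (𝓝 0) ∧
    Tendsto (fun m => eLpNorm (fun x => fderiv ℝ (w m) x - weakGrad Ω u x) 2
      (volume.restrict Ω)) atTop (𝓝 0) ∧
    Tendsto (fun m => eLpNorm (fun x => w m x - h x) 2 ((μH[1] : Measure Plane).restrict s))
      atTop (𝓝 0)

open Classical in
/-- The trace on `s` of a function in `H¹(Ω; F)`. -/
noncomputable def trace (Ω s : Set Plane) (u : Plane → F) : Plane → F :=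
  if h : ∃ g, HasTrace Ω s u g then h.choose else 0

/-- Functions in `H¹(Ω; F)` whose trace vanishes on `s`. -/
def MemH1Zero (Ω s : Set Plane) (u : Plane → F) : Prop :=
  MemH1 Ω u ∧ HasTrace Ω s u 0

/-- The `L²(Ω; F)` inner product. -/
noncomputable def l2Inner (Ω : Set Plane) (u v : Plane → F) : ℝ :=
  ∫ x in Ω, inner ℝ (u x) (v x)

/-- The `L²(Ω; F)` norm. -/
noncomputable def l2Norm (Ω : Set Plane) (u : Plane → F) : ℝ :=
  Real.sqrt (∫ x in Ω, ‖u x‖ ^ 2)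

/-- The inner product `(∇u, ∇v)` in `L²(Ω)`, with the Frobenius product of gradients. -/
noncomputable def gradInner (Ω : Set Plane) (u v : Plane → F) : ℝ :=
  ∫ x in Ω, ∑ i : Fin 2,
    inner ℝ (weakGrad Ω u x (basisVec i)) (weakGrad Ω v x (basisVec i))

end Sobolev

/-- The weak gradient of a scalar function as a coordinate vector. -/
noncomputable def gradVec (Ω : Set Plane) (ψ : Plane → ℝ) (x : Plane) : Fin 2 → ℝ :=
  fun i => weakGrad Ω ψ x (basisVec i)

/-- `(A ∇φ, ∇ψ)` in `L²(Ω)`. In particular `weightedGradInner Ω A φ φ` is `‖√A ∇φ‖²` when `A` is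
symmetric positive definite. -/
noncomputable def weightedGradInner (Ω : Set Plane) (A : Plane → Matrix (Fin 2) (Fin 2) ℝ)
    (φ ψ : Plane → ℝ) : ℝ :=
  ∫ x in Ω, (A x *ᵥ gradVec Ω φ x) ⬝ᵥ gradVec Ω ψ x

/-- The weak divergence of a vector field. -/
noncomputable def weakDiv (Ω : Set Plane) (u : Plane → Plane) (x : Plane) : ℝ :=
  ∑ i : Fin 2, weakGrad Ω u x (basisVec i) i

/-! ## The ensemble of Navier--Stokes--Darcy problems -/

/-- The deterministic data of the ensemble: free-flow region, porous region, unit normal pointing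
out of the free-flow region and unit tangent along the interface, viscosity, gravitational
acceleration, storativity, Beavers--Joseph--Saffman constant, and the conductivity tensors. -/
structure Model (J : ℕ) where
  Ωf : Set Plane
  Ωp : Set Plane
  n : Plane → Plane
  τ : Plane → Plane
  ν : ℝ
  g : ℝ
  S : ℝ
  αBJ : ℝ
  K : Fin J → Plane → Matrix (Fin 2) (Fin 2) ℝ

namespace Model

variable {J : ℕ} (D : Model J)

/-- The interface. -/
def Γ : Set Plane := frontier D.Ωf ∩ frontier D.Ωp

def Γf : Set Plane := frontier D.Ωf \ D.Γ

def Γp : Set Plane := frontier D.Ωp \ D.Γ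

/-- The standing assumptions on the data. -/
structure Admissible : Prop where
  lipschitz_f : IsLipschitzDomain D.Ωf
  lipschitz_p : IsLipschitzDomain D.Ωp
  disjoint : Disjoint D.Ωf D.Ωp
  nonempty_Γf : D.Γf.Nonempty
  nonempty_Γp : D.Γp.Nonempty
  measurable_n : Measurable D.n
  measurable_τ : Measurable D.τ
  normal : ∀ᵐ x ∂((μH[1] : Measure Plane).restrict D.Γ), IsOuterNormal D.Ωf x (D.n x)
  tangent : ∀ᵐ x ∂((μH[1] : Measure Plane).restrict D.Γ),
    ‖D.τ x‖ = 1 ∧ inner ℝ (D.τ x) (D.n x) = 0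
  ν_pos : 0 < D.ν
  g_pos : 0 < D.g
  S_pos : 0 < D.S
  αBJ_nonneg : 0 ≤ D.αBJ
  measurable_K : ∀ j a b, Measurable (fun x => D.K j x a b)
  symm_K : ∀ j, ∀ x ∈ D.Ωp ∪ D.Γ, (D.K j x).IsSymm
  elliptic_K : ∀ j, ∃ kmin kmax : ℝ, 0 < kmin ∧ ∀ x ∈ D.Ωp ∪ D.Γ, ∀ z : Fin 2 → ℝ,
    kmin * (z ⬝ᵥ z) ≤ z ⬝ᵥ (D.K j x *ᵥ z) ∧ z ⬝ᵥ (D.K j x *ᵥ z) ≤ kmax * (z ⬝ᵥ z)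

/-- The velocity space. -/
def MemXf (v : Plane → Plane) : Prop := MemH1Zero D.Ωf D.Γf v

/-- The hydraulic head space. -/
def MemXp (ψ : Plane → ℝ) : Prop := MemH1Zero D.Ωp D.Γp ψ

/-- The pressure space. -/
def MemQf (q : Plane → ℝ) : Prop := MemLp q 2 (volume.restrict D.Ωf)

/-- Ensemble mean of the conductivity tensors. -/
noncomputable def Kbar (x : Plane) : Matrix (Fin 2) (Fin 2) ℝ := (1 / (J : ℝ)) • ∑ j, D.K j x

/-- The slip coefficient `αBJ ν √d / √(τ · K_j τ)`, with `d = 2`. -/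
noncomputable def η (j : Fin J) (x : Plane) : ℝ :=
  D.αBJ * D.ν * Real.sqrt 2 / Real.sqrt (D.τ x ⬝ᵥ (D.K j x *ᵥ D.τ x))

/-- Ensemble mean of the slip coefficients. -/
noncomputable def ηbar (x : Plane) : ℝ := (1 / (J : ℝ)) * ∑ j, D.η j x

/-- Interface trace of a velocity. -/
noncomputable def trF (v : Plane → Plane) : Plane → Plane := trace D.Ωf D.Γ v

/-- Interface trace of a hydraulic head. -/
noncomputable def trP (ψ : Plane → ℝ) : Plane → ℝ := trace D.Ωp D.Γ ψ

/-- `(c u · τ, v · τ)_Γ` for a scalar weight `c`. In particular `slip c u u` is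
`‖√c u · τ‖²_Γ` when `c` is nonnegative. -/
noncomputable def slip (c : Plane → ℝ) (u v : Plane → Plane) : ℝ :=
  ∫ x in D.Γ, c x * inner ℝ (D.trF u x) (D.τ x) * inner ℝ (D.trF v x) (D.τ x) ∂μH[1]

/-- The interface coupling `(g ψ, v · n_f)_Γ`. -/
noncomputable def coupling (v : Plane → Plane) (ψ : Plane → ℝ) : ℝ :=
  ∫ x in D.Γ, D.g * D.trP ψ x * inner ℝ (D.trF v x) (D.n x) ∂μH[1]

/-- The viscous form `ν (∇u, ∇v)`. -/
noncomputable def formA (u v : Plane → Plane) : ℝ := D.ν * gradInner D.Ωf u v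

/-- The form `(∇ · v, p)`. -/
noncomputable def formB (v : Plane → Plane) (p : Plane → ℝ) : ℝ :=
  ∫ x in D.Ωf, weakDiv D.Ωf v x * p x

/-- The convective form `((u · ∇) v, w) - 1/2 ∫_Γ (u · v) (w · n_f)`. -/
noncomputable def formD (u v w : Plane → Plane) : ℝ :=
  (∫ x in D.Ωf, inner ℝ (weakGrad D.Ωf v x (u x)) (w x)) -
  (1 / 2) * ∫ x in D.Γ, inner ℝ (D.trF u x) (D.trF v x) * inner ℝ (D.trF w x) (D.n x) ∂μH[1]

/-- The energy `1/2 ‖u‖² + 1/2 g S ‖φ‖²`. -/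
noncomputable def energy (u : Plane → Plane) (φ : Plane → ℝ) : ℝ :=
  (1 / 2) * l2Norm D.Ωf u ^ 2 + (1 / 2) * D.g * D.S * l2Norm D.Ωp φ ^ 2

end Model

/-! ## Generalized backward differentiation operators of order 2, 3, 4 -/

/-- The leading coefficient. -/
noncomputable def gbdfα (k : ℕ) (β : ℝ) : ℝ :=
  match k with
  | 2 => (2 * β + 1) / 2
  | 3 => (3 * β ^ 2 + 6 * β + 2) / 6
  | 4 => (2 * β ^ 3 + 9 * β ^ 2 + 11 * β + 3) / 12
  | _ => 0

section Operators

variable {V : Type*} [AddCommGroup V] [Module ℝ V]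

/-- The lagged part of the discrete derivative, evaluated at the sequence `w` and the index `n`
(used only for `k - 1 ≤ n`). -/
noncomputable def gbdfAbar (k : ℕ) (β : ℝ) (w : ℕ → V) (n : ℕ) : V :=
  match k with
  | 2 => (-2 * β) • w n + ((2 * β - 1) / 2) • w (n - 1)
  | 3 => (-(9 * β ^ 2 + 12 * β - 3) / 6) • w n + ((9 * β ^ 2 + 6 * β - 6) / 6) • w (n - 1)
      + (-(3 * β ^ 2 - 1) / 6) • w (n - 2)
  | 4 => ((-8 * β ^ 3 - 30 * β ^ 2 - 20 * β + 10) / 12) • w n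
      + ((12 * β ^ 3 + 36 * β ^ 2 + 6 * β - 18) / 12) • w (n - 1)
      + ((-8 * β ^ 3 - 18 * β ^ 2 + 4 * β + 6) / 12) • w (n - 2)
      + ((2 * β ^ 3 + 3 * β ^ 2 - β - 1) / 12) • w (n - 3)
  | _ => 0

/-- The implicit interpolation operator. -/
noncomputable def gbdfB (k : ℕ) (β : ℝ) (w : ℕ → V) (n : ℕ) : V :=
  match k with
  | 2 => β • w n + (-(β - 1)) • w (n - 1)
  | 3 => ((β ^ 2 + β) / 2) • w n + (-(β ^ 2 - 1)) • w (n - 1) + ((β ^ 2 - β) / 2) • w (n - 2)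
  | 4 => ((β ^ 3 + 3 * β ^ 2 + 2 * β) / 6) • w n
      + ((-β ^ 3 - 2 * β ^ 2 + β + 2) / 2) • w (n - 1)
      + ((β ^ 3 + β ^ 2 - 2 * β) / 2) • w (n - 2)
      + ((-β ^ 3 + β) / 6) • w (n - 3)
  | _ => 0

/-- The explicit extrapolation operator. -/
noncomputable def gbdfC (k : ℕ) (β : ℝ) (w : ℕ → V) (n : ℕ) : V :=
  match k with
  | 2 => (β + 1) • w n + (-β) • w (n - 1)
  | 3 => ((β ^ 2 + 3 * β + 2) / 2) • w n + (-(β ^ 2 + 2 * β)) • w (n - 1)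
      + ((β ^ 2 + β) / 2) • w (n - 2)
  | 4 => ((β ^ 3 + 6 * β ^ 2 + 11 * β + 6) / 6) • w n
      + ((-β ^ 3 - 5 * β ^ 2 - 6 * β) / 2) • w (n - 1)
      + ((β ^ 3 + 4 * β ^ 2 + 3 * β) / 2) • w (n - 2)
      + ((-β ^ 3 - 3 * β ^ 2 - 2 * β) / 6) • w (n - 3)
  | _ => 0

end Operators

/-! ## The scheme -/

/-- The forcing terms: `ff j t x` and `fp j t x`. -/
structure Forcing (J : ℕ) where
  ff : Fin J → ℝ → Plane → Plane
  fp : Fin J → ℝ → Plane → ℝ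

/-- At all times the forcing terms are square integrable with norms at most `Cf`. -/
def Forcing.BoundedBy {J : ℕ} (f : Forcing J) (D : Model J) (Cf : ℝ) : Prop :=
  ∀ j, ∀ t : ℝ, 0 ≤ t →
    MemLp (f.ff j t) 2 (volume.restrict D.Ωf) ∧ l2Norm D.Ωf (f.ff j t) ≤ Cf ∧
    MemLp (f.fp j t) 2 (volume.restrict D.Ωp) ∧ l2Norm D.Ωp (f.fp j t) ≤ Cf

/-- A family of discrete trajectories, indexed by the ensemble member and the time level. -/
structure Trajectory (J : ℕ) where
  ubar : Fin J → ℕ → Plane → Plane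
  u : Fin J → ℕ → Plane → Plane
  p : Fin J → ℕ → Plane → ℝ
  φbar : Fin J → ℕ → Plane → ℝ
  φ : Fin J → ℕ → Plane → ℝ
  r : Fin J → ℕ → ℝ
  ξ : Fin J → ℕ → ℝ

namespace Trajectory

variable {J : ℕ} (X : Trajectory J) (D : Model J) (f : Forcing J) (k : ℕ) (β Δt : ℝ)
  (Cr α γ : Fin J → ℝ)

/-- All fields at level `m` lie in their function spaces. -/
def InSpaces (j : Fin J) (m : ℕ) : Prop :=
  D.MemXf (X.ubar j m) ∧ D.MemXf (X.u j m) ∧ D.MemQf (X.p j m) ∧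
  D.MemXp (X.φbar j m) ∧ D.MemXp (X.φ j m)

/-- The momentum equation for level `n + 1`. -/
def Momentum (j : Fin J) (n : ℕ) : Prop :=
  ∀ v : Plane → Plane, D.MemXf v →
    l2Inner D.Ωf ((1 / Δt) • (gbdfα k β • X.ubar j (n + 1) + gbdfAbar k β (X.u j) n)) v
    + D.slip D.ηbar (gbdfB k β (X.ubar j) (n + 1)) v
    + D.slip (fun x => D.η j x - D.ηbar x) (gbdfC k β (X.ubar j) n) v
    + D.formA (gbdfB k β (X.ubar j) (n + 1)) v
    + D.formD (gbdfC k β (X.ubar j) n) (gbdfC k β (X.ubar j) n) v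
    - D.formB v (gbdfB k β (X.p j) (n + 1))
    + D.coupling v (gbdfC k β (X.φbar j) n)
    = l2Inner D.Ωf (f.ff j ((n + β) * Δt)) v

/-- The discrete incompressibility constraint for level `n + 1`. -/
def Incompressibility (j : Fin J) (n : ℕ) : Prop :=
  ∀ q : Plane → ℝ, D.MemQf q → D.formB (gbdfB k β (X.ubar j) (n + 1)) q = 0

/-- The Darcy equation for level `n + 1`. -/
def Darcy (j : Fin J) (n : ℕ) : Prop :=
  ∀ ψ : Plane → ℝ, D.MemXp ψ →
    D.g * D.S *
      l2Inner D.Ωp ((1 / Δt) • (gbdfα k β • X.φbar j (n + 1) + gbdfAbar k β (X.φ j) n)) ψ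
    + D.g * weightedGradInner D.Ωp D.Kbar (gbdfB k β (X.φbar j) (n + 1)) ψ
    + D.g * weightedGradInner D.Ωp (fun x => D.K j x - D.Kbar x) (gbdfC k β (X.φbar j) n) ψ
    - D.coupling (gbdfC k β (X.ubar j) n) ψ
    = D.g * l2Inner D.Ωp (f.fp j ((n + β) * Δt)) ψ

/-- The stabilization term `(α_j / 2) (‖f_f‖² + ‖g f_p‖²)` at level `m`. -/
noncomputable def forceTerm (j : Fin J) (m : ℕ) : ℝ :=
  (α j / 2) * (l2Norm D.Ωf (f.ff j (m * Δt)) ^ 2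
    + l2Norm D.Ωp (D.g • f.fp j (m * Δt)) ^ 2)

/-- The expression in braces in the auxiliary variable equation, at level `m`. -/
noncomputable def dissipation (j : Fin J) (m : ℕ) : ℝ :=
  D.ν * gradInner D.Ωf (X.ubar j m) (X.ubar j m)
  + D.g * weightedGradInner D.Ωp (D.K j) (X.φbar j m) (X.φbar j m)
  + D.slip (D.η j) (X.ubar j m) (X.ubar j m)
  - l2Inner D.Ωf (f.ff j (m * Δt)) (X.ubar j m)
  - l2Inner D.Ωp (D.g • f.fp j (m * Δt)) (X.φbar j m)
  + forceTerm D f Δt α j m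
  - (γ j / 2) * (l2Norm D.Ωf (X.ubar j m) ^ 2 + D.g * D.S * l2Norm D.Ωp (X.φbar j m) ^ 2)

/-- The equation for the auxiliary variable `r` at level `n + 1`. -/
def Auxiliary (j : Fin J) (n : ℕ) : Prop :=
  (X.r j (n + 1) - X.r j n) / Δt + γ j * X.r j (n + 1)
    = - (X.r j (n + 1) / (D.energy (X.ubar j (n + 1)) (X.φbar j (n + 1)) + Cr j))
        * X.dissipation D f Δt α γ j (n + 1)
      + forceTerm D f Δt α j (n + 1) + γ j * Cr j

/-- The scalar `η_k = 1 - (1 - ξ)^(k + 1)` at level `m`. -/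
noncomputable def scaling (j : Fin J) (m : ℕ) : ℝ := 1 - (1 - X.ξ j m) ^ (k + 1)

/-- Definition of `ξ` and correction of the velocity and of the head at level `n + 1`. -/
def Correction (j : Fin J) (n : ℕ) : Prop :=
  X.ξ j (n + 1) = X.r j (n + 1) / (D.energy (X.ubar j (n + 1)) (X.φbar j (n + 1)) + Cr j) ∧
  X.u j (n + 1) =ᵐ[volume.restrict D.Ωf] X.scaling k j (n + 1) • X.ubar j (n + 1) ∧
  X.φ j (n + 1) =ᵐ[volume.restrict D.Ωp] X.scaling k j (n + 1) • X.φbar j (n + 1)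

/-- `X` is produced by the `k`-step ensemble scheme with parameter `β`, step `Δt` and final time
`T`: the levels `0, …, k - 1` are starting values in the right spaces, and each level `n + 1` with
`k ≤ n + 1 ≤ T / Δt` solves the equations of the scheme. -/
structure IsSchemeSolution (T : ℝ) : Prop where
  start : ∀ j, ∀ m : ℕ, m < k → X.InSpaces D j m
  step : ∀ j, ∀ n : ℕ, k ≤ n + 1 → ((n : ℝ) + 1) ≤ T / Δt →
    X.InSpaces D j (n + 1) ∧
    X.Momentum D f k β Δt j n ∧
    X.Incompressibility D k β j n ∧
    X.Darcy D f k β Δt j n ∧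
    X.Auxiliary D f Δt Cr α γ j n ∧
    X.Correction D k Cr j n

end Trajectory

end NSD

namespace NSD

open scoped ENNReal NNReal

/-! The bound is a discrete maximum principle for the scalar `r`. With the expression in braces
abbreviated to `d`, the auxiliary equation reads `r' * (1/Δt + γ + d/(E + C)) = r/Δt + F + γ * C`.
If `d ≥ 0`, the bracket is positive, so `r > 0` forces `r' > 0`, and any `M ≥ r` with `γ * M ≥ F + γ
* C` bounds `r'` too. Such an `M` depends on neither the step nor the number of steps
(`auxiliary_step`). The fields are bounded because `1 - (1 - ξ)^(k+1)` is divisible by `ξ = r'/(E +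
C)`: the scaled field is at most a constant times `r' * ‖ubar‖/(E + C)`, and `E` is quadratic in the
norms (`scaled_norm_le`).

What remains is `d ≥ 0` for suitable `α`, `γ` (`exists_dissipation_constants`). Young's inequality
absorbs the forcing and half of the coercivity; the rest pays for the `γ` term. Coercivity is
Friedrichs' inequality in `X_f` and `X_p`.

Friedrichs' inequality is proved for smooth functions by integrating along segments. A small ball
next to the boundary is controlled by sliding it onto the boundary piece `s`; control spreads to
every interior point by connectedness, reaches the boundary by pushing points into the domain along
the graph direction, and becomes global by compactness of the closure (`controlled_domain`). The
approximating sequence in the definition of zero trace carries it over to Sobolev functions. -/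

theorem ennreal_add_sq_le (a b : ℝ≥0∞) : (a + b) ^ 2 ≤ 4 * (a ^ 2 + b ^ 2) := by
  have h4 : (4 : ℝ≥0∞) = 2 ^ 2 := by norm_num
  rcases le_total a b with h | h
  · calc (a + b) ^ 2 ≤ (2 * b) ^ 2 := by gcongr; rw [two_mul]; gcongr
      _ = 4 * b ^ 2 := by rw [mul_pow, h4]
      _ ≤ _ := by gcongr; exact le_add_self
  · calc (a + b) ^ 2 ≤ (2 * a) ^ 2 := by gcongr; rw [two_mul]; gcongr
      _ = 4 * a ^ 2 := by rw [mul_pow, h4]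
      _ ≤ _ := by gcongr; exact le_self_add

theorem sq_lintegral_le {X : Type*} [MeasurableSpace X] (μ : Measure X) {f : X → ℝ≥0∞}
    (hf : AEMeasurable f μ) : (∫⁻ x, f x ∂μ) ^ 2 ≤ μ Set.univ * ∫⁻ x, f x ^ 2 ∂μ := by
  have h := ENNReal.lintegral_mul_le_Lp_mul_Lq μ Real.HolderConjugate.two_two hf
    (aemeasurable_const (b := (1 : ℝ≥0∞)))
  simp only [Pi.mul_apply, mul_one, ENNReal.one_rpow, lintegral_const, one_mul] at h
  calc (∫⁻ x, f x ∂μ) ^ 2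
      ≤ ((∫⁻ a, f a ^ (2 : ℝ) ∂μ) ^ (1 / 2 : ℝ) * μ Set.univ ^ (1 / 2 : ℝ)) ^ 2 := by gcongr
    _ = μ Set.univ * ∫⁻ x, f x ^ 2 ∂μ := by
      rw [mul_pow, ← ENNReal.rpow_natCast, ← ENNReal.rpow_mul, ← ENNReal.rpow_natCast,
        ← ENNReal.rpow_mul, mul_comm]
      simp

/-! ### Integration along parallel segments -/

section Line

variable {F : Type*} [NormedAddCommGroup F] [InnerProductSpace ℝ F] [CompleteSpace F]

theorem enorm_le_add_lintegral_fderiv {w : Plane → F} (hw : ContDiff ℝ ∞ w) (x v : Plane)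
    {l : ℝ} (hl : 0 ≤ l) :
    ‖w x‖ₑ ≤ ‖w (x + l • v)‖ₑ + ‖v‖ₑ * ∫⁻ t in Set.Ioo 0 l, ‖fderiv ℝ w (x + t • v)‖ₑ := by
  have hd : ∀ t ∈ Set.uIcc (0 : ℝ) l,
      HasDerivAt (fun t : ℝ => w (x + t • v)) (fderiv ℝ w (x + t • v) v) t := by
    intro t _
    have h1 : HasDerivAt (fun t : ℝ => x + t • v) v t := by
      simpa using ((hasDerivAt_id t).smul_const v).const_add x
    exact ((hw.differentiable (by simp)) _).hasFDerivAt.comp_hasDerivAt t h1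
  have hc : Continuous (fun t : ℝ => fderiv ℝ w (x + t • v)) :=
    (hw.continuous_fderiv (by simp)).comp (by fun_prop)
  have hint := intervalIntegral.integral_eq_sub_of_hasDerivAt hd
    ((hc.clm_apply continuous_const).intervalIntegrable _ _)
  have e1 : w x = w (x + l • v) - ∫ t in (0 : ℝ)..l, fderiv ℝ w (x + t • v) v := by
    rw [hint]; simp
  calc ‖w x‖ₑ ≤ ‖w (x + l • v)‖ₑ + ‖∫ t in (0 : ℝ)..l, fderiv ℝ w (x + t • v) v‖ₑ := by
        conv_lhs => rw [e1]
        exact enorm_sub_le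
    _ ≤ _ := by
        gcongr
        rw [intervalIntegral.integral_of_le hl, integral_Ioc_eq_integral_Ioo]
        refine (enorm_integral_le_lintegral_enorm _).trans ?_
        rw [← lintegral_const_mul _ (by fun_prop)]
        refine lintegral_mono fun t => ?_
        rw [mul_comm]
        exact ContinuousLinearMap.le_opENorm _ _

/-- Estimate of `w` on `A` by its values at the ends of parallel segments running through `Ω`. -/
theorem lintegral_sq_le_along_segments {Ω A : Set Plane} (hΩ : MeasurableSet Ω)
    (hA : MeasurableSet A) (v : Plane) {L : ℝ} {l : Plane → ℝ}
    (hl0 : ∀ x ∈ A, 0 ≤ l x) (hlL : ∀ x ∈ A, l x ≤ L)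
    (hseg : ∀ x ∈ A, ∀ t ∈ Set.Ioo 0 (l x), x + t • v ∈ Ω)
    {w : Plane → F} (hw : ContDiff ℝ ∞ w) :
    ∫⁻ x in A, ‖w x‖ₑ ^ 2 ≤ 4 * (∫⁻ x in A, ‖w (x + l x • v)‖ₑ ^ 2) +
      4 * (‖v‖ₑ * ENNReal.ofReal L) ^ 2 * ∫⁻ x in Ω, ‖fderiv ℝ w x‖ₑ ^ 2 := by
  -- Extending the gradient by zero replaces the variable length `l x` by the fixed interval `(0,
  -- L)`, so that Tonelli applies.
  set f : Plane → ℝ≥0∞ := Ω.indicator (fun x => ‖fderiv ℝ w x‖ₑ) with hf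
  have hfm : Measurable f :=
    ((hw.continuous_fderiv (by simp)).enorm.measurable).indicator hΩ
  have hf2 : ∀ x, f x ^ 2 = Ω.indicator (fun x => ‖fderiv ℝ w x‖ₑ ^ 2) x := by
    intro x
    by_cases hx : x ∈ Ω <;> simp [hf, hx]
  have hjm : Measurable (fun q : Plane × ℝ => f (q.1 + q.2 • v) ^ 2) :=
    (hfm.comp (by fun_prop)).pow_const 2
  have hpt : ∀ x ∈ A, ‖w x‖ₑ ^ 2 ≤ 4 * ‖w (x + l x • v)‖ₑ ^ 2 +
      4 * (‖v‖ₑ ^ 2 * ENNReal.ofReal L) * ∫⁻ t in Set.Ioo 0 L, f (x + t • v) ^ 2 := by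
    intro x hx
    have h1 := enorm_le_add_lintegral_fderiv hw x v (hl0 x hx)
    have h2 : ∫⁻ t in Set.Ioo 0 (l x), ‖fderiv ℝ w (x + t • v)‖ₑ
        ≤ ∫⁻ t in Set.Ioo 0 L, f (x + t • v) := by
      calc ∫⁻ t in Set.Ioo 0 (l x), ‖fderiv ℝ w (x + t • v)‖ₑ
          = ∫⁻ t in Set.Ioo 0 (l x), f (x + t • v) := by
            refine setLIntegral_congr_fun measurableSet_Ioo fun t ht => ?_
            simp [hf, hseg x hx t ht]
        _ ≤ _ := lintegral_mono_set (Set.Ioo_subset_Ioo_right (hlL x hx))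
    have h3 := sq_lintegral_le (volume.restrict (Set.Ioo 0 L))
      (f := fun t => f (x + t • v)) (hfm.comp (by fun_prop)).aemeasurable
    rw [Measure.restrict_apply_univ, Real.volume_Ioo, sub_zero] at h3
    calc ‖w x‖ₑ ^ 2 ≤ (‖w (x + l x • v)‖ₑ + ‖v‖ₑ * ∫⁻ t in Set.Ioo 0 L, f (x + t • v)) ^ 2 := by
          gcongr; exact h1.trans (by gcongr)
      _ ≤ 4 * (‖w (x + l x • v)‖ₑ ^ 2 + (‖v‖ₑ * ∫⁻ t in Set.Ioo 0 L, f (x + t • v)) ^ 2) :=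
          ennreal_add_sq_le _ _
      _ ≤ 4 * (‖w (x + l x • v)‖ₑ ^ 2 +
          ‖v‖ₑ ^ 2 * (ENNReal.ofReal L * ∫⁻ t in Set.Ioo 0 L, f (x + t • v) ^ 2)) := by
          rw [mul_pow]; gcongr
      _ = _ := by ring
  have hinner : Measurable fun x : Plane => ∫⁻ t in Set.Ioo 0 L, f (x + t • v) ^ 2 :=
    hjm.lintegral_prod_right'
  calc ∫⁻ x in A, ‖w x‖ₑ ^ 2
      ≤ ∫⁻ x in A, (4 * ‖w (x + l x • v)‖ₑ ^ 2 +
        4 * (‖v‖ₑ ^ 2 * ENNReal.ofReal L) * ∫⁻ t in Set.Ioo 0 L, f (x + t • v) ^ 2) :=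
        setLIntegral_mono' hA hpt
    _ = 4 * (∫⁻ x in A, ‖w (x + l x • v)‖ₑ ^ 2) + 4 * (‖v‖ₑ ^ 2 * ENNReal.ofReal L) *
        ∫⁻ x in A, ∫⁻ t in Set.Ioo 0 L, f (x + t • v) ^ 2 := by
        -- `l` need not be measurable: additivity uses measurability of the second summand only, and
        -- the finite constant 4 leaves the first integral without any.
        rw [lintegral_add_right _ (hinner.const_mul _), lintegral_const_mul _ hinner,
          lintegral_const_mul' _ _ (by norm_num)]
    _ ≤ 4 * (∫⁻ x in A, ‖w (x + l x • v)‖ₑ ^ 2) + 4 * (‖v‖ₑ ^ 2 * ENNReal.ofReal L) *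
        (ENNReal.ofReal L * ∫⁻ x in Ω, ‖fderiv ℝ w x‖ₑ ^ 2) := by
        gcongr
        -- For fixed `t` the shift by `t • v` preserves area, so each slice is at most the integral
        -- over `Ω`; integrating in `t` gives the factor `L`.
        rw [lintegral_lintegral_swap hjm.aemeasurable]
        calc ∫⁻ t in Set.Ioo 0 L, ∫⁻ x in A, f (x + t • v) ^ 2
            ≤ ∫⁻ t in Set.Ioo 0 L, ∫⁻ x in Ω, ‖fderiv ℝ w x‖ₑ ^ 2 := by
              refine lintegral_mono fun t => ?_
              calc ∫⁻ x in A, f (x + t • v) ^ 2 ≤ ∫⁻ x, f (x + t • v) ^ 2 :=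
                    setLIntegral_le_lintegral _ _
                _ = ∫⁻ x, f x ^ 2 := lintegral_add_right_eq_self (fun x => f x ^ 2) _
                _ = _ := by simp_rw [hf2]; exact lintegral_indicator hΩ _
          _ = _ := by simp [mul_comm]
    _ = _ := by ring

end Line

/-! ### Sets controlled by the gradient and the boundary values -/

section Controlled

variable (F : Type*) [NormedAddCommGroup F] [InnerProductSpace ℝ F]

/-- The `L²(A)` norm of smooth functions is bounded by the `L²(Ω)` norm of their gradients and the
`L²(s)` norm of their values, where `s` carries the arc length. -/
def Controlled (Ω s A : Set Plane) : Prop :=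
  ∃ C : ℝ≥0, ∀ w : Plane → F, ContDiff ℝ ∞ w →
    ∫⁻ x in A, ‖w x‖ₑ ^ 2 ≤
      C * ((∫⁻ x in Ω, ‖fderiv ℝ w x‖ₑ ^ 2) + ∫⁻ x in s, ‖w x‖ₑ ^ 2 ∂(μH[1] : Measure Plane))

variable {F} {Ω s A B : Set Plane}

theorem Controlled.mono (hB : Controlled F Ω s B) (h : A ⊆ B) : Controlled F Ω s A := by
  obtain ⟨C, hC⟩ := hB
  exact ⟨C, fun w hw => (lintegral_mono_set h).trans (hC w hw)⟩

theorem Controlled.union (hA : Controlled F Ω s A) (hB : Controlled F Ω s B) :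
    Controlled F Ω s (A ∪ B) := by
  obtain ⟨C, hC⟩ := hA
  obtain ⟨C', hC'⟩ := hB
  refine ⟨C + C', fun w hw => (lintegral_union_le _ _ _).trans ?_⟩
  rw [ENNReal.coe_add, add_mul]
  exact add_le_add (hC w hw) (hC' w hw)

theorem Controlled.empty : Controlled F Ω s ∅ := ⟨0, by simp⟩

/-- Each value on `A` differs from a value on `B` by the integral of the gradient along a segment in
`Ω`. This is the step by which control spreads from one set to another. -/
theorem Controlled.translate [CompleteSpace F] (hΩ : MeasurableSet Ω) (hA : MeasurableSet A)
    (hBm : MeasurableSet B) (hB : Controlled F Ω s B) (v : Plane)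
    (hseg : ∀ x ∈ A, ∀ t ∈ Set.Ioo (0 : ℝ) 1, x + t • v ∈ Ω) (hend : ∀ x ∈ A, x + v ∈ B) :
    Controlled F Ω s A := by
  obtain ⟨C, hC⟩ := hB
  refine ⟨4 * C + 4 * ‖v‖₊ ^ 2, fun w hw => ?_⟩
  have h := lintegral_sq_le_along_segments hΩ hA v (L := 1) (l := fun _ => 1) (by simp) (by simp)
    hseg hw
  have h2 : ∫⁻ x in A, ‖w (x + (1 : ℝ) • v)‖ₑ ^ 2 ≤ ∫⁻ x in B, ‖w x‖ₑ ^ 2 := by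
    rw [← lintegral_indicator hBm, ← lintegral_indicator hA,
      ← lintegral_add_right_eq_self (B.indicator _) v]
    refine lintegral_mono fun x => ?_
    by_cases hx : x ∈ A
    · simp [hx, hend x hx]
    · simp [hx]
  calc ∫⁻ x in A, ‖w x‖ₑ ^ 2
      ≤ 4 * (∫⁻ x in B, ‖w x‖ₑ ^ 2) + 4 * ‖v‖ₑ ^ 2 * ∫⁻ x in Ω, ‖fderiv ℝ w x‖ₑ ^ 2 := by
        refine h.trans ?_
        rw [ENNReal.ofReal_one, mul_one]
        gcongr
    _ ≤ 4 * (C * ((∫⁻ x in Ω, ‖fderiv ℝ w x‖ₑ ^ 2) +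
          ∫⁻ x in s, ‖w x‖ₑ ^ 2 ∂(μH[1] : Measure Plane))) +
        4 * ‖v‖ₑ ^ 2 * ((∫⁻ x in Ω, ‖fderiv ℝ w x‖ₑ ^ 2) +
          ∫⁻ x in s, ‖w x‖ₑ ^ 2 ∂(μH[1] : Measure Plane)) := by
        gcongr
        · exact hC w hw
        · exact le_self_add
    _ = _ := by
        rw [enorm_eq_nnnorm]
        push_cast
        ring

end Controlled

/-! ### Rotated coordinates and boundary graphs -/

section Coordinates

/-- In the rotated coordinates the ball lies in a square of side `2 * δ`, over which the integral
factors. -/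
theorem setLIntegral_comp_coord_le (e : Plane ≃ₗᵢ[ℝ] Plane) (c : Plane) (δ : ℝ)
    {g : ℝ → ℝ≥0∞} (hg : Measurable g) :
    ∫⁻ x in Metric.ball c δ, g (e x 0) ≤
      ENNReal.ofReal (2 * δ) * ∫⁻ t in Metric.ball (e c 0) δ, g t := by
  set f : ℝ → ℝ≥0∞ := (Metric.ball (e c 0) δ).indicator g with hf
  set k : ℝ → ℝ≥0∞ := (Metric.ball (e c 1) δ).indicator (fun _ => 1) with hk
  have hfm : Measurable f := hg.indicator measurableSet_ball
  have hkm : Measurable k := measurable_const.indicator measurableSet_ball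
  have hcoord : ∀ x ∈ Metric.ball c δ, ∀ i, e x i ∈ Metric.ball (e c i) δ := by
    intro x hx i
    rw [Metric.mem_ball, dist_eq_norm] at hx ⊢
    calc ‖e x i - e c i‖ = ‖(e x - e c) i‖ := by simp
      _ ≤ ‖e x - e c‖ := PiLp.norm_apply_le _ _
      _ = ‖x - c‖ := by rw [← map_sub, e.norm_map]
      _ < δ := hx
  have hmp : MeasurePreserving (fun x : Plane => (e x 0, e x 1)) volume
      (volume : Measure (ℝ × ℝ)) :=
    ((volume_preserving_finTwoArrow ℝ).comp
      (PiLp.volume_preserving_ofLp (Fin 2))).comp e.measurePreserving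
  calc ∫⁻ x in Metric.ball c δ, g (e x 0)
      ≤ ∫⁻ x, f (e x 0) * k (e x 1) := by
        rw [← lintegral_indicator measurableSet_ball]
        refine lintegral_mono fun x => ?_
        by_cases hx : x ∈ Metric.ball c δ
        · simp [-Metric.mem_ball, hf, hk, hx, hcoord x hx]
        · simp [-Metric.mem_ball, hx]
    _ = ∫⁻ z : ℝ × ℝ, f z.1 * k z.2 := by
        exact hmp.lintegral_comp (f := fun z : ℝ × ℝ => f z.1 * k z.2)
          ((hfm.comp measurable_fst).mul (hkm.comp measurable_snd))
    _ = (∫⁻ t, f t) * ∫⁻ t, k t := by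
        rw [Measure.volume_eq_prod]
        exact lintegral_prod_mul hfm.aemeasurable hkm.aemeasurable
    _ = _ := by
        rw [hf, hk, lintegral_indicator measurableSet_ball, lintegral_indicator measurableSet_ball]
        simp [mul_comm]

/-- Integrals over a graph with respect to arc length dominate integrals over the parameter. -/
theorem setLIntegral_le_graph (e : Plane ≃ₗᵢ[ℝ] Plane) {s : Set Plane} {I : Set ℝ}
    {p : ℝ → Plane} (hp : Measurable p) (hpe : ∀ t, e (p t) 0 = t)
    (hps : ∀ t ∈ I, p t ∈ s) (hI : MeasurableSet I) {G : Plane → ℝ≥0∞} (hG : Measurable G) :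
    ∫⁻ t in I, G (p t) ≤ ∫⁻ x in s, G x ∂(μH[1] : Measure Plane) := by
  set π : Plane → ℝ := fun x => e x 0 with hπ
  have hπl : LipschitzWith 1 π := by
    refine LipschitzWith.of_dist_le_mul fun x y => ?_
    rw [NNReal.coe_one, one_mul, dist_eq_norm, dist_eq_norm]
    calc ‖e x 0 - e y 0‖ = ‖(e x - e y) 0‖ := by simp
      _ ≤ ‖e x - e y‖ := PiLp.norm_apply_le _ _
      _ = ‖x - y‖ := by rw [← map_sub, e.norm_map]
  have hπm : Measurable π := hπl.continuous.measurable
  -- The arc is described by measurable equations because `s` itself need not be measurable.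
  set gr : Set Plane := {x | p (π x) = x ∧ π x ∈ I} with hgr
  have hgrm : MeasurableSet gr :=
    (measurableSet_eq_fun (hp.comp hπm) measurable_id).inter (hπm hI)
  have hgrs : gr ⊆ s := fun x hx => hx.1 ▸ hps _ hx.2
  -- The projection `π` is 1-Lipschitz, so it does not increase one-dimensional Hausdorff measure,
  -- which on the line is Lebesgue measure.
  have hle : (volume.restrict I : Measure ℝ) ≤
      ((μH[1] : Measure Plane).restrict gr).map π := by
    refine Measure.le_iff.2 fun S hS => ?_
    rw [Measure.map_apply hπm hS, Measure.restrict_apply hS, Measure.restrict_apply (hπm hS),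
      ← hausdorffMeasure_real]
    have himg : S ∩ I ⊆ π '' (π ⁻¹' S ∩ gr) := by
      rintro t ⟨htS, htI⟩
      have ht : π (p t) = t := hpe t
      exact ⟨p t, ⟨by simpa [ht] using htS, by simp [hgr, ht, htI]⟩, ht⟩
    refine (measure_mono himg).trans ?_
    simpa using hπl.hausdorffMeasure_image_le zero_le_one (π ⁻¹' S ∩ gr)
  calc ∫⁻ t in I, G (p t)
      ≤ ∫⁻ t, G (p t) ∂((μH[1] : Measure Plane).restrict gr).map π :=
        lintegral_mono' hle le_rfl
    _ = ∫⁻ x in gr, G (p (π x)) ∂(μH[1] : Measure Plane) :=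
        lintegral_map (hG.comp hp) hπm
    _ = ∫⁻ x in gr, G x ∂(μH[1] : Measure Plane) :=
        setLIntegral_congr_fun hgrm fun x hx => by simp only [hx.1]
    _ ≤ _ := lintegral_mono_set hgrs

end Coordinates

section Chart

variable {Ω : Set Plane} {e : Plane ≃ₗᵢ[ℝ] Plane} {h : ℝ → ℝ} {x₀ : Plane} {ρ : ℝ}

theorem norm_le_abs_add_abs (z : Plane) : ‖z‖ ≤ |z 0| + |z 1| := by
  rw [EuclideanSpace.norm_eq, Fin.sum_univ_two, Real.norm_eq_abs, Real.norm_eq_abs]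
  refine Real.sqrt_le_iff.2 ⟨by positivity, ?_⟩
  nlinarith [abs_nonneg (z 0), abs_nonneg (z 1), mul_nonneg (abs_nonneg (z 0)) (abs_nonneg (z 1))]

theorem dist_le_coord (e : Plane ≃ₗᵢ[ℝ] Plane) (x y : Plane) :
    dist x y ≤ |e x 0 - e y 0| + |e x 1 - e y 1| := by
  rw [← e.dist_map, dist_eq_norm]
  simpa using norm_le_abs_add_abs (e x - e y)

theorem abs_coord_sub_le (e : Plane ≃ₗᵢ[ℝ] Plane) (x y : Plane) (i : Fin 2) :
    |e x i - e y i| ≤ dist x y := by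
  rw [← e.dist_map, dist_eq_norm]
  simpa using PiLp.norm_apply_le (e x - e y) i

theorem coord_zero_add_up (e : Plane ≃ₗᵢ[ℝ] Plane) (x : Plane) (t : ℝ) :
    e (x + t • e.symm (basisVec 1)) 0 = e x 0 := by
  simp [basisVec]

theorem coord_one_add_up (e : Plane ≃ₗᵢ[ℝ] Plane) (x : Plane) (t : ℝ) :
    e (x + t • e.symm (basisVec 1)) 1 = e x 1 + t := by
  simp [basisVec]

theorem norm_up (e : Plane ≃ₗᵢ[ℝ] Plane) : ‖e.symm (basisVec 1)‖ = 1 := by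
  simp [basisVec]

theorem continuous_coord (e : Plane ≃ₗᵢ[ℝ] Plane) (i : Fin 2) : Continuous fun x => e x i :=
  (EuclideanSpace.proj (𝕜 := ℝ) i).continuous.comp e.continuous

/-- Points just above `y` lie in `Ω` and converge to `y`, while `y` itself is not in `Ω`. -/
theorem mem_frontier_of_graph (hΩ : IsOpen Ω)
    (hgr : ∀ y ∈ Metric.ball x₀ ρ, (y ∈ Ω ↔ h (e y 0) < e y 1)) {y : Plane}
    (hy : y ∈ Metric.ball x₀ ρ) (hyg : e y 1 = h (e y 0)) : y ∈ frontier Ω := by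
  rw [hΩ.frontier_eq]
  refine ⟨?_, fun hyΩ => by have := (hgr y hy).1 hyΩ; linarith⟩
  have hlim : Tendsto (fun t : ℝ => y + t • e.symm (basisVec 1)) (𝓝[>] 0) (𝓝 y) := by
    have : Continuous fun t : ℝ => y + t • e.symm (basisVec 1) := by fun_prop
    simpa using (this.tendsto 0).mono_left nhdsWithin_le_nhds
  refine mem_closure_of_tendsto hlim ?_
  filter_upwards [hlim.eventually (Metric.isOpen_ball.mem_nhds hy), self_mem_nhdsWithin]
    with t ht ht0
  rw [hgr _ ht, coord_zero_add_up, coord_one_add_up]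
  have : (0 : ℝ) < t := ht0
  linarith

/-- A centre above the graph would lie in the open set `Ω`; one below it would have a neighbourhood
that misses `Ω`. -/
theorem graph_of_mem_frontier (hΩ : IsOpen Ω) (hh : Continuous h) (hρ : 0 < ρ)
    (hgr : ∀ y ∈ Metric.ball x₀ ρ, (y ∈ Ω ↔ h (e y 0) < e y 1)) (hx : x₀ ∈ frontier Ω) :
    e x₀ 1 = h (e x₀ 0) := by
  rw [hΩ.frontier_eq] at hx
  have hxb : x₀ ∈ Metric.ball x₀ ρ := Metric.mem_ball_self hρ
  refine le_antisymm (not_lt.1 fun hlt => hx.2 ((hgr _ hxb).2 hlt)) (not_lt.1 fun hlt => ?_)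
  have ho : IsOpen (Metric.ball x₀ ρ ∩ {y | e y 1 < h (e y 0)}) :=
    Metric.isOpen_ball.inter
      (isOpen_lt (continuous_coord e 1) (hh.comp (continuous_coord e 0)))
  obtain ⟨y, ⟨hyb, hyl⟩, hyΩ⟩ := mem_closure_iff.1 hx.1 _ ho ⟨hxb, hlt⟩
  have := (hgr y hyb).1 hyΩ
  exact absurd hyl (not_lt.2 this.le)

end Chart

/-! ### Friedrichs' inequality for smooth functions -/

section Friedrichs

variable {F : Type*} [NormedAddCommGroup F] [InnerProductSpace ℝ F] [CompleteSpace F]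
  {Ω s : Set Plane}

/-- Vertical segments lead from a small ball above `x₀` down through `Ω` to the graph, where they
end in `s`; the end values are then bounded by the arc length integral. -/
theorem exists_controlled_ball_near_boundary (hΩ : IsLipschitzDomain Ω) {x₀ : Plane}
    (hx₀ : x₀ ∈ frontier Ω) {ρ₀ : ℝ} (hρ₀ : 0 < ρ₀) (hs : Metric.ball x₀ ρ₀ ∩ frontier Ω ⊆ s) :
    ∃ y ∈ Ω, ∃ δ > 0, Controlled F Ω s (Metric.ball y δ) := by
  obtain ⟨e, K, h, ρ₁, hρ₁, hK, hgr₁⟩ := hΩ.graph x₀ hx₀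
  have hh := hK.continuous
  have hx₀g := graph_of_mem_frontier hΩ.isOpen hh hρ₁ hgr₁ hx₀
  set ρ := min ρ₀ ρ₁ with hρdef
  have hρ : 0 < ρ := lt_min hρ₀ hρ₁
  have hgr : ∀ y ∈ Metric.ball x₀ ρ, (y ∈ Ω ↔ h (e y 0) < e y 1) := fun y hy =>
    hgr₁ y (Metric.ball_subset_ball (min_le_right _ _) hy)
  have hgs : ∀ y ∈ Metric.ball x₀ ρ, e y 1 = h (e y 0) → y ∈ s := fun y hy hyg =>
    hs ⟨Metric.ball_subset_ball (min_le_left _ _) hy, mem_frontier_of_graph hΩ.isOpen hgr hy hyg⟩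
  obtain ⟨δ₀, hδ₀, hhδ⟩ := Metric.continuousAt_iff.1 (hh.continuousAt (x := e x₀ 0)) (ρ / 8)
    (by positivity)
  set δ := min δ₀ (ρ / 8) with hδdef
  have hδ : 0 < δ := lt_min hδ₀ (by positivity)
  have hδρ : δ ≤ ρ / 8 := min_le_right _ _
  have hh8 : ∀ t, |t - e x₀ 0| < δ → |h t - e x₀ 1| < ρ / 8 := by
    intro t ht
    have := hhδ (x := t) (by rw [Real.dist_eq]; exact ht.trans_le (min_le_left _ _))
    rwa [Real.dist_eq, ← hx₀g] at this
  set v := e.symm (basisVec 1) with hv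
  -- Relative to `x₀`, the graph stays within height `ρ / 8` over the `δ`-interval, and the ball
  -- around `c` at height `ρ / 4` has radius at most `ρ / 8`. Hence the segments have length between
  -- 0 and `ρ / 2` and remain in the chart.
  set c : Plane := x₀ + (ρ / 4) • v with hc
  have hc0 : e c 0 = e x₀ 0 := coord_zero_add_up e _ _
  have hc1 : e c 1 = e x₀ 1 + ρ / 4 := coord_one_add_up e _ _
  have hA : ∀ x ∈ Metric.ball c δ,
      |e x 0 - e x₀ 0| < δ ∧ |e x 1 - (e x₀ 1 + ρ / 4)| < ρ / 8 := by
    intro x hx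
    rw [Metric.mem_ball] at hx
    rw [← hc0, ← hc1]
    exact ⟨(abs_coord_sub_le e x c 0).trans_lt hx,
      ((abs_coord_sub_le e x c 1).trans_lt hx).trans_le hδρ⟩
  have hball : ∀ z, |e z 0 - e x₀ 0| < δ → |e z 1 - e x₀ 1| ≤ ρ / 2 → z ∈ Metric.ball x₀ ρ := by
    intro z h0 h1
    rw [Metric.mem_ball]
    have := dist_le_coord e z x₀
    linarith
  set p : ℝ → Plane := fun t => x₀ + (t - e x₀ 0) • e.symm (basisVec 0) + (h t - e x₀ 1) • v
    with hp
  have hp0 : ∀ t, e (p t) 0 = t := by intro t; simp [hp, hv, basisVec]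
  have hp1 : ∀ t, e (p t) 1 = h t := by intro t; simp [hp, hv, basisVec]
  have hpm : Continuous p := by fun_prop
  have hps : ∀ t ∈ Metric.ball (e c 0) δ, p t ∈ s := by
    intro t ht
    rw [Metric.mem_ball, Real.dist_eq, hc0] at ht
    refine hgs _ (hball _ (by rwa [hp0]) ?_) (by rw [hp0, hp1])
    rw [hp1]
    linarith [hh8 t ht]
  have hcΩ : c ∈ Ω := by
    rw [hgr c (hball c (by rw [hc0]; simpa using hδ) (by
      rw [hc1, add_sub_cancel_left, abs_of_pos (by positivity)]; linarith)), hc0, hc1]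
    linarith
  refine ⟨c, hcΩ, δ, hδ, 4 * Real.toNNReal (2 * δ) + 4 * Real.toNNReal (ρ / 2) ^ 2,
    fun w hw => ?_⟩
  have hend : ∀ x, x + (e x 1 - h (e x 0)) • -v = p (e x 0) := by
    intro x
    apply e.injective
    ext i
    fin_cases i
    · simp [hp, hv, basisVec]
    · simp [hp, hv, basisVec]
  have key := lintegral_sq_le_along_segments hΩ.isOpen.measurableSet
    (measurableSet_ball (x := c) (ε := δ)) (-v) (L := ρ / 2) (l := fun x => e x 1 - h (e x 0))
    (fun x hx => by
      obtain ⟨h0, h1⟩ := hA x hx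
      have := abs_lt.1 (hh8 _ h0)
      have := abs_lt.1 h1
      linarith)
    (fun x hx => by
      obtain ⟨h0, h1⟩ := hA x hx
      have := abs_lt.1 (hh8 _ h0)
      have := abs_lt.1 h1
      linarith)
    (fun x hx t ht => by
      obtain ⟨h0, h1⟩ := hA x hx
      have h2 := abs_lt.1 (hh8 _ h0)
      have h3 := abs_lt.1 h1
      have hx0 : e (x + t • -v) 0 = e x 0 := by
        rw [smul_neg, ← neg_smul]; exact coord_zero_add_up e _ _
      have hx1 : e (x + t • -v) 1 = e x 1 + -t := by
        rw [smul_neg, ← neg_smul]; exact coord_one_add_up e _ _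
      rw [hgr _ (hball _ (by rwa [hx0]) (by
        rw [hx1, abs_le]; constructor <;> linarith [ht.1, ht.2])), hx0, hx1]
      linarith [ht.2]) hw
  have hwm : Measurable fun x => ‖w x‖ₑ ^ 2 := (hw.continuous.enorm.measurable).pow_const 2
  have hgraph : ∫⁻ x in Metric.ball c δ, ‖w (x + (e x 1 - h (e x 0)) • -v)‖ₑ ^ 2 ≤
      ENNReal.ofReal (2 * δ) * ∫⁻ x in s, ‖w x‖ₑ ^ 2 ∂(μH[1] : Measure Plane) := by
    simp_rw [hend]
    refine (setLIntegral_comp_coord_le e c δ (g := fun t => ‖w (p t)‖ₑ ^ 2)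
      (hwm.comp hpm.measurable)).trans ?_
    gcongr
    exact setLIntegral_le_graph e hpm.measurable hp0 hps measurableSet_ball hwm
  have hv1 : ‖-v‖ₑ = 1 := by
    rw [enorm_neg, enorm_eq_nnnorm, ENNReal.coe_eq_one, ← NNReal.coe_eq_one]
    exact norm_up e
  rw [hv1, one_mul] at key
  refine key.trans ?_
  set a := ∫⁻ x in Ω, ‖fderiv ℝ w x‖ₑ ^ 2
  set b := ∫⁻ x in s, ‖w x‖ₑ ^ 2 ∂(μH[1] : Measure Plane)
  calc _ ≤ 4 * (ENNReal.ofReal (2 * δ) * b) + 4 * ENNReal.ofReal (ρ / 2) ^ 2 * a := by gcongr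
    _ ≤ 4 * (ENNReal.ofReal (2 * δ) * (a + b)) + 4 * ENNReal.ofReal (ρ / 2) ^ 2 * (a + b) := by
      gcongr
      · exact le_add_self
      · exact le_self_add
    _ = _ := by
      push_cast
      simp only [ENNReal.ofReal]
      ring

/-- The centres of controlled balls form an open set. It is relatively closed in `Ω`, since a
controlled ball near `z` can be translated to `z` inside a disc contained in `Ω`; connectedness
concludes. -/
theorem controlled_ball_of_mem (hΩ : IsOpen Ω) (hc : IsPreconnected Ω) {y : Plane} (hy : y ∈ Ω)
    {δ : ℝ} (hδ : 0 < δ) (hyδ : Controlled F Ω s (Metric.ball y δ)) {x : Plane} (hx : x ∈ Ω) :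
    ∃ r > 0, Controlled F Ω s (Metric.ball x r) := by
  set U : Set Plane := {x | ∃ r > 0, Controlled F Ω s (Metric.ball x r)} with hU
  have hUo : IsOpen U := by
    rw [Metric.isOpen_iff]
    rintro z ⟨r, hr, hz⟩
    refine ⟨r / 2, by positivity, fun z' hz' => ⟨r / 2, by positivity, hz.mono ?_⟩⟩
    refine Metric.ball_subset_ball' ?_
    rw [Metric.mem_ball] at hz'
    linarith
  have hsub : Ω ⊆ U := by
    refine hc.subset_of_closure_inter_subset hUo ⟨y, hy, δ, hδ, hyδ⟩ ?_
    rintro z ⟨hzU, hzΩ⟩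
    obtain ⟨ρ, hρ, hball⟩ := Metric.isOpen_iff.1 hΩ z hzΩ
    obtain ⟨z', ⟨r, hr, hz'⟩, hzz'⟩ := Metric.mem_closure_iff.1 hzU (ρ / 2) (by positivity)
    refine ⟨min r (ρ / 2), lt_min hr (by positivity), ?_⟩
    refine hz'.translate hΩ.measurableSet measurableSet_ball measurableSet_ball (z' - z) ?_ ?_
    · intro q hq t ht
      apply hball
      rw [Metric.mem_ball, dist_eq_norm] at hq ⊢
      rw [dist_comm, dist_eq_norm] at hzz'
      calc ‖q + t • (z' - z) - z‖ = ‖(q - z) + t • (z' - z)‖ := by congr 1; abel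
        _ ≤ ‖q - z‖ + ‖t • (z' - z)‖ := norm_add_le _ _
        _ = ‖q - z‖ + t * ‖z' - z‖ := by rw [norm_smul, Real.norm_of_nonneg ht.1.le]
        _ < ρ / 2 + ρ / 2 := by
          have := hq.trans_le (min_le_right _ _)
          nlinarith [ht.1, ht.2, norm_nonneg (z' - z)]
        _ = ρ := by ring
    · intro q hq
      rw [Metric.mem_ball, dist_eq_norm] at hq ⊢
      have : q + (z' - z) - z' = q - z := by abel
      rw [this]
      exact hq.trans_le (min_le_left _ _)
  exact hsub hx

/-- Every point of the compact closure has a neighbourhood whose part in `Ω` is controlled, and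
finite unions preserve control. -/
theorem controlled_domain (hΩ : IsLipschitzDomain Ω) {x₀ : Plane}
    (hx₀ : x₀ ∈ frontier Ω) {ρ₀ : ℝ} (hρ₀ : 0 < ρ₀) (hs : Metric.ball x₀ ρ₀ ∩ frontier Ω ⊆ s) :
    Controlled F Ω s Ω := by
  obtain ⟨y, hy, δ, hδ, hyδ⟩ := exists_controlled_ball_near_boundary (F := F) hΩ hx₀ hρ₀ hs
  have hint : ∀ x ∈ Ω, ∃ r > 0, Controlled F Ω s (Metric.ball x r) := fun x hx =>
    controlled_ball_of_mem hΩ.isOpen hΩ.isConnected.isPreconnected hy hδ hyδ hx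
  have hloc : ∀ x ∈ closure Ω, ∃ r > 0, Controlled F Ω s (Metric.ball x r ∩ Ω) := by
    intro x hx
    by_cases hxΩ : x ∈ Ω
    · obtain ⟨r, hr, h⟩ := hint x hxΩ
      exact ⟨r, hr, h.mono Set.inter_subset_left⟩
    have hxf : x ∈ frontier Ω := by rw [hΩ.isOpen.frontier_eq]; exact ⟨hx, hxΩ⟩
    obtain ⟨e, K, h, ρ, hρ, hK, hgr⟩ := hΩ.graph x hxf
    have hxg := graph_of_mem_frontier hΩ.isOpen hK.continuous hρ hgr hxf
    -- Upward motion keeps points above the graph, hence in `Ω`. Starting within `ρ / 2` of `x` and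
    -- moving less than `ρ / 2` stays in the chart.
    set v := (ρ / 2) • e.symm (basisVec 1) with hv
    have hvn : ‖v‖ = ρ / 2 := by
      rw [hv, norm_smul, norm_up, mul_one, Real.norm_of_nonneg (by positivity)]
    have hxv : x + v ∈ Ω := by
      rw [hgr, coord_zero_add_up, coord_one_add_up]
      · linarith
      · rw [Metric.mem_ball, dist_eq_norm, add_sub_cancel_left, hvn]; linarith
    obtain ⟨r, hr, hB⟩ := hint _ hxv
    refine ⟨min r (ρ / 2), lt_min hr (by positivity), ?_⟩
    refine hB.translate hΩ.isOpen.measurableSet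
      (measurableSet_ball.inter hΩ.isOpen.measurableSet) measurableSet_ball v ?_ ?_
    · rintro q ⟨hq, hqΩ⟩ t ht
      rw [Metric.mem_ball, dist_eq_norm] at hq
      have hq2 := hq.trans_le (min_le_right _ _)
      have hqb : q ∈ Metric.ball x ρ := by
        rw [Metric.mem_ball, dist_eq_norm]; linarith
      have hqg := (hgr q hqb).1 hqΩ
      rw [hv, smul_smul, hgr, coord_zero_add_up, coord_one_add_up]
      · nlinarith [ht.1]
      · rw [← smul_smul, ← hv, Metric.mem_ball, dist_eq_norm]
        calc ‖q + t • v - x‖ = ‖(q - x) + t • v‖ := by congr 1; abel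
          _ ≤ ‖q - x‖ + ‖t • v‖ := norm_add_le _ _
          _ = ‖q - x‖ + t * (ρ / 2) := by rw [norm_smul, Real.norm_of_nonneg ht.1.le, hvn]
          _ < ρ := by nlinarith [ht.1, ht.2]
    · rintro q ⟨hq, -⟩
      rw [Metric.mem_ball, dist_eq_norm] at hq ⊢
      have : q + v - (x + v) = q - x := by abel
      rw [this]
      exact hq.trans_le (min_le_left _ _)
  have hcomp : IsCompact (closure Ω) := hΩ.isBounded.isCompact_closure
  have : Controlled F Ω s (closure Ω ∩ Ω) := by
    refine hcomp.induction_on (p := fun A => Controlled F Ω s (A ∩ Ω)) ?_ ?_ ?_ ?_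
    · simpa using Controlled.empty
    · exact fun A B hAB hB => hB.mono (Set.inter_subset_inter_left _ hAB)
    · intro A B hA hB
      rw [Set.union_inter_distrib_right]
      exact hA.union hB
    · intro x hx
      obtain ⟨r, hr, h⟩ := hloc x hx
      exact ⟨_, mem_nhdsWithin_of_mem_nhds (Metric.ball_mem_nhds x hr), h⟩
  exact this.mono fun x hx => ⟨subset_closure hx, hx⟩

end Friedrichs

/-! ### From smooth functions to Sobolev functions -/

section L2Norm

variable {F : Type*} [NormedAddCommGroup F] {Ω : Set Plane}

theorem l2Norm_sq (u : Plane → F) : l2Norm Ω u ^ 2 = ∫ x in Ω, ‖u x‖ ^ 2 :=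
  Real.sq_sqrt (by positivity)

theorem l2Norm_nonneg (u : Plane → F) : 0 ≤ l2Norm Ω u := Real.sqrt_nonneg _

theorem l2Norm_congr {u v : Plane → F} (h : u =ᵐ[volume.restrict Ω] v) :
    l2Norm Ω u = l2Norm Ω v := by
  rw [l2Norm, l2Norm]
  congr 1
  exact integral_congr_ae (h.mono fun x hx => by simp only [hx])

theorem eLpNorm_le_sub_add {X G : Type*} [MeasurableSpace X] [NormedAddCommGroup G]
    {μ : Measure X} {f g : X → G} (hf : AEStronglyMeasurable f μ)
    (hg : AEStronglyMeasurable g μ) :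
    eLpNorm f 2 μ ≤ eLpNorm (fun x => g x - f x) 2 μ + eLpNorm g 2 μ := by
  have e : f = g - (g - f) := by abel
  calc eLpNorm f 2 μ = eLpNorm (g - (g - f)) 2 μ := by rw [← e]
    _ ≤ eLpNorm g 2 μ + eLpNorm (g - f) 2 μ := eLpNorm_sub_le hg (hg.sub hf) (by norm_num)
    _ = _ := add_comm _ _

theorem eLpNorm_le_sub_add' {X G : Type*} [MeasurableSpace X] [NormedAddCommGroup G]
    {μ : Measure X} {f g : X → G} (hf : AEStronglyMeasurable f μ)
    (hg : AEStronglyMeasurable g μ) :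
    eLpNorm g 2 μ ≤ eLpNorm (fun x => g x - f x) 2 μ + eLpNorm f 2 μ := by
  have e : g = (g - f) + f := by abel
  calc eLpNorm g 2 μ = eLpNorm ((g - f) + f) 2 μ := by rw [← e]
    _ ≤ _ := eLpNorm_add_le (hg.sub hf) hf (by norm_num)

end L2Norm

section Friedrichs

variable {F : Type*} [NormedAddCommGroup F] [InnerProductSpace ℝ F] {Ω s : Set Plane}

theorem eLpNorm_two_sq {X G : Type*} [MeasurableSpace X] [NormedAddCommGroup G] (μ : Measure X)
    (f : X → G) : eLpNorm f 2 μ ^ 2 = ∫⁻ x, ‖f x‖ₑ ^ 2 ∂μ := by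
  have := eLpNorm_nnreal_pow_eq_lintegral (μ := μ) (f := f) (p := 2) two_ne_zero
  simpa using this

theorem integral_norm_sq_eq {X G : Type*} [MeasurableSpace X] [NormedAddCommGroup G]
    {μ : Measure X} {f : X → G} (hf : MemLp f 2 μ) :
    ∫ x, ‖f x‖ ^ 2 ∂μ = (eLpNorm f 2 μ ^ 2).toReal := by
  have hm : AEStronglyMeasurable (fun x => ‖f x‖ ^ 2) μ := hf.1.norm.pow 2
  rw [eLpNorm_two_sq, integral_eq_lintegral_of_nonneg_ae (.of_forall fun x => by positivity) hm]
  congr 1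
  refine lintegral_congr fun x => ?_
  rw [ENNReal.ofReal_pow (norm_nonneg _), ofReal_norm]

theorem MemH1.memLp_weakGrad {u : Plane → F} (hu : MemH1 Ω u) :
    MemLp (weakGrad Ω u) 2 (volume.restrict Ω) := by
  have h := hu.2
  rw [weakGrad, dif_pos h]
  exact h.choose_spec.1

/-- Cauchy–Schwarz in the coordinates. It passes from the operator norm, used in the segment
estimates, to the Frobenius norm in `gradInner`. -/
theorem opNorm_sq_le (T : Plane →L[ℝ] F) :
    ‖T‖ ^ 2 ≤ ∑ i : Fin 2, ‖T (basisVec i)‖ ^ 2 := by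
  have h : ‖T‖ ≤ √(∑ i : Fin 2, ‖T (basisVec i)‖ ^ 2) := by
    refine T.opNorm_le_bound (Real.sqrt_nonneg _) fun x => ?_
    have hx : x = x 0 • basisVec 0 + x 1 • basisVec 1 := by
      ext i; fin_cases i <;> simp [basisVec]
    have h1 : ‖T x‖ ≤ |x 0| * ‖T (basisVec 0)‖ + |x 1| * ‖T (basisVec 1)‖ := by
      conv_lhs => rw [hx]
      rw [map_add, map_smul, map_smul]
      refine (norm_add_le _ _).trans ?_
      rw [norm_smul, norm_smul, Real.norm_eq_abs, Real.norm_eq_abs]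
    rw [EuclideanSpace.norm_eq, ← Real.sqrt_mul (Finset.sum_nonneg fun _ _ => by positivity),
      Fin.sum_univ_two, Fin.sum_univ_two, Real.norm_eq_abs, Real.norm_eq_abs]
    refine h1.trans (Real.le_sqrt_of_sq_le ?_)
    nlinarith [sq_nonneg (|x 0| * ‖T (basisVec 1)‖ - |x 1| * ‖T (basisVec 0)‖)]
  calc ‖T‖ ^ 2 ≤ √(∑ i : Fin 2, ‖T (basisVec i)‖ ^ 2) ^ 2 := by gcongr
    _ = _ := Real.sq_sqrt (Finset.sum_nonneg fun _ _ => by positivity)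

theorem MemH1.memLp_weakGrad_apply {u : Plane → F} (hu : MemH1 Ω u) (v : Plane) :
    MemLp (fun x => weakGrad Ω u x v) 2 (volume.restrict Ω) :=
  (ContinuousLinearMap.apply ℝ F v).comp_memLp' hu.memLp_weakGrad

theorem MemH1.integrable_gradSq {u : Plane → F} (hu : MemH1 Ω u) :
    Integrable (fun x => ∑ i : Fin 2, ‖weakGrad Ω u x (basisVec i)‖ ^ 2)
      (volume.restrict Ω) :=
  integrable_finsetSum _ fun i _ => (hu.memLp_weakGrad_apply (basisVec i)).integrable_norm_pow
    two_ne_zero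

theorem gradInner_self (u : Plane → F) :
    gradInner Ω u u = ∫ x in Ω, ∑ i : Fin 2, ‖weakGrad Ω u x (basisVec i)‖ ^ 2 := by
  simp [gradInner]

theorem gradInner_self_nonneg (u : Plane → F) : 0 ≤ gradInner Ω u u := by
  rw [gradInner_self]
  positivity

/-- The estimate passes to the limit along the smooth sequence witnessing the zero trace, whose
boundary norms tend to 0. That sequence converges to the very gradient chosen by `weakGrad`, so no
uniqueness of weak gradients is needed. -/
theorem MemH1Zero.eLpNorm_le {C : ℝ≥0} (hC : ∀ w : Plane → F, ContDiff ℝ ∞ w →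
      ∫⁻ x in Ω, ‖w x‖ₑ ^ 2 ≤ C * ((∫⁻ x in Ω, ‖fderiv ℝ w x‖ₑ ^ 2) +
        ∫⁻ x in s, ‖w x‖ₑ ^ 2 ∂(μH[1] : Measure Plane)))
    {u : Plane → F} (hu : MemH1Zero Ω s u) :
    eLpNorm u 2 (volume.restrict Ω) ≤
      NNReal.sqrt C * eLpNorm (weakGrad Ω u) 2 (volume.restrict Ω) := by
  obtain ⟨hu1, -, w, hw, hwu, hwg, hwt⟩ := hu
  set μ := volume.restrict Ω
  set B := NNReal.sqrt C
  have hsm : ∀ m, eLpNorm (w m) 2 μ ≤ B * (eLpNorm (fderiv ℝ (w m)) 2 μ +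
      eLpNorm (w m) 2 ((μH[1] : Measure Plane).restrict s)) := by
    intro m
    have h := hC (w m) (hw m)
    rw [← eLpNorm_two_sq, ← eLpNorm_two_sq, ← eLpNorm_two_sq] at h
    rw [← ENNReal.pow_le_pow_left_iff two_ne_zero]
    refine h.trans ?_
    rw [mul_pow, ← ENNReal.coe_pow, NNReal.sq_sqrt, add_sq]
    gcongr
    exact le_self_add
  have hbd : ∀ m, eLpNorm u 2 μ ≤ eLpNorm (fun x => w m x - u x) 2 μ +
      B * ((eLpNorm (fun x => fderiv ℝ (w m) x - weakGrad Ω u x) 2 μ +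
        eLpNorm (weakGrad Ω u) 2 μ) +
        eLpNorm (fun x => w m x - (0 : Plane → F) x) 2 ((μH[1] : Measure Plane).restrict s)) := by
    intro m
    have hwm : AEStronglyMeasurable (w m) μ := (hw m).continuous.aestronglyMeasurable
    have hgm : AEStronglyMeasurable (fderiv ℝ (w m)) μ :=
      ((hw m).continuous_fderiv (by simp)).aestronglyMeasurable
    have h1 := eLpNorm_le_sub_add hu1.1.1 hwm
    have h2 := eLpNorm_le_sub_add' hu1.memLp_weakGrad.1 hgm
    simp only [Pi.zero_apply, sub_zero]
    calc eLpNorm u 2 μ ≤ eLpNorm (fun x => w m x - u x) 2 μ + eLpNorm (w m) 2 μ := h1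
      _ ≤ _ := by
        gcongr
        refine (hsm m).trans ?_
        gcongr
  have hlim := hwu.add (ENNReal.Tendsto.const_mul (a := (B : ℝ≥0∞))
    ((hwg.add (tendsto_const_nhds (x := eLpNorm (weakGrad Ω u) 2 μ))).add hwt)
    (Or.inr ENNReal.coe_ne_top))
  simpa using ge_of_tendsto' hlim hbd

/-- Friedrichs' inequality for functions vanishing on a relatively open part of the boundary. -/
theorem friedrichs [CompleteSpace F] (hΩ : IsLipschitzDomain Ω) {x₀ : Plane}
    (hx₀ : x₀ ∈ frontier Ω) {ρ₀ : ℝ} (hρ₀ : 0 < ρ₀) (hs : Metric.ball x₀ ρ₀ ∩ frontier Ω ⊆ s) :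
    ∃ c > 0, ∀ u : Plane → F, MemH1Zero Ω s u → c * l2Norm Ω u ^ 2 ≤ gradInner Ω u u := by
  obtain ⟨C, hC⟩ := controlled_domain (F := F) hΩ hx₀ hρ₀ hs
  have hC1 : (0 : ℝ) < C + 1 := by positivity
  -- `C + 1` avoids division by zero when `C = 0`.
  refine ⟨1 / (C + 1), by positivity, fun u hu => ?_⟩
  have h := hu.eLpNorm_le hC
  have hg := hu.1.memLp_weakGrad
  have h1 : l2Norm Ω u ^ 2 ≤ C * ∫ x in Ω, ‖weakGrad Ω u x‖ ^ 2 := by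
    rw [l2Norm_sq, integral_norm_sq_eq hu.1.1, integral_norm_sq_eq hg, ← ENNReal.coe_toReal C,
      ← ENNReal.toReal_mul]
    refine ENNReal.toReal_mono (by finiteness [hg.2]) ?_
    calc _ ≤ _ := pow_le_pow_left' h 2
      _ = _ := by rw [mul_pow, ← ENNReal.coe_pow, NNReal.sq_sqrt]
  have h2 : ∫ x in Ω, ‖weakGrad Ω u x‖ ^ 2 ≤ gradInner Ω u u := by
    rw [gradInner_self]
    exact integral_mono (hg.integrable_norm_pow two_ne_zero) hu.1.integrable_gradSq
      fun x => opNorm_sq_le _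
  rw [div_mul_eq_mul_div, one_mul, div_le_iff₀ hC1]
  calc l2Norm Ω u ^ 2 ≤ C * ∫ x in Ω, ‖weakGrad Ω u x‖ ^ 2 := h1
    _ ≤ C * gradInner Ω u u := by gcongr
    _ ≤ _ := by nlinarith [gradInner_self_nonneg (Ω := Ω) u]

end Friedrichs

/-! ### Young's inequality and ellipticity -/

section Estimates

variable {F : Type*} [NormedAddCommGroup F] [InnerProductSpace ℝ F] {Ω : Set Plane}

theorem l2Inner_le {f u : Plane → F} (hf : MemLp f 2 (volume.restrict Ω))
    (hu : MemLp u 2 (volume.restrict Ω)) {a : ℝ} (ha : 0 < a) :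
    l2Inner Ω f u ≤ a / 2 * l2Norm Ω f ^ 2 + 1 / (2 * a) * l2Norm Ω u ^ 2 := by
  have hf2 := hf.integrable_norm_pow two_ne_zero
  have hu2 := hu.integrable_norm_pow two_ne_zero
  have hfu : Integrable (fun x => inner ℝ (f x) (u x)) (volume.restrict Ω) := by
    refine (hf2.add hu2).mono' (hf.1.inner hu.1) (.of_forall fun x => ?_)
    have := norm_inner_le_norm (𝕜 := ℝ) (f x) (u x)
    simp only [Pi.add_apply]
    nlinarith [sq_nonneg (‖f x‖ - ‖u x‖), sq_nonneg ‖f x‖, sq_nonneg ‖u x‖]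
  rw [l2Norm_sq, l2Norm_sq, l2Inner, ← integral_const_mul, ← integral_const_mul,
    ← integral_add (hf2.const_mul _) (hu2.const_mul _)]
  refine integral_mono hfu ((hf2.const_mul _).add (hu2.const_mul _)) fun x => ?_
  have h1 := real_inner_le_norm (f x) (u x)
  have h2 : a / 2 * ‖f x‖ ^ 2 + 1 / (2 * a) * ‖u x‖ ^ 2 - ‖f x‖ * ‖u x‖ =
      (a * ‖f x‖ - ‖u x‖) ^ 2 / (2 * a) := by
    field_simp
    ring
  have h3 : 0 ≤ (a * ‖f x‖ - ‖u x‖) ^ 2 / (2 * a) := by positivity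
  simp only []
  linarith

theorem l2Norm_smul (c : ℝ) (u : Plane → F) : l2Norm Ω (c • u) = |c| * l2Norm Ω u := by
  rw [l2Norm, l2Norm, ← Real.sqrt_sq_eq_abs, ← Real.sqrt_mul (sq_nonneg c),
    ← integral_const_mul]
  simp [norm_smul, mul_pow]

/-- The lower ellipticity bound is the estimate pointwise. The upper one makes the weighted
integrand integrable; otherwise its integral would be the default value 0. -/
theorem mul_gradInner_le_weighted {A : Plane → Matrix (Fin 2) (Fin 2) ℝ}
    (hΩ : MeasurableSet Ω) (hA : ∀ a b, Measurable fun x => A x a b) {κ κ' : ℝ} (hκ : 0 < κ)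
    (hA1 : ∀ x ∈ Ω, ∀ z : Fin 2 → ℝ, κ * (z ⬝ᵥ z) ≤ z ⬝ᵥ (A x *ᵥ z))
    (hA2 : ∀ x ∈ Ω, ∀ z : Fin 2 → ℝ, z ⬝ᵥ (A x *ᵥ z) ≤ κ' * (z ⬝ᵥ z))
    {φ : Plane → ℝ} (hφ : MemH1 Ω φ) :
    κ * gradInner Ω φ φ ≤ weightedGradInner Ω A φ φ := by
  have hsq : ∀ x, ∑ i : Fin 2, ‖weakGrad Ω φ x (basisVec i)‖ ^ 2 =
      gradVec Ω φ x ⬝ᵥ gradVec Ω φ x := by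
    intro x
    simp [gradVec, dotProduct, ← sq]
  have hint := hφ.integrable_gradSq
  rw [gradInner_self, weightedGradInner, ← integral_const_mul]
  simp_rw [hsq] at hint ⊢
  have hgm : ∀ i, AEStronglyMeasurable (fun x => gradVec Ω φ x i) (volume.restrict Ω) :=
    fun i => (hφ.memLp_weakGrad_apply (basisVec i)).1
  have hAm : ∀ a b, AEStronglyMeasurable (fun x => A x a b) (volume.restrict Ω) :=
    fun a b => (hA a b).aestronglyMeasurable
  have hm : AEStronglyMeasurable (fun x => (A x *ᵥ gradVec Ω φ x) ⬝ᵥ gradVec Ω φ x)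
      (volume.restrict Ω) := by
    simp only [Matrix.mulVec, dotProduct, Fin.sum_univ_two]
    exact ((((hAm 0 0).mul (hgm 0)).add ((hAm 0 1).mul (hgm 1))).mul (hgm 0)).add
      ((((hAm 1 0).mul (hgm 0)).add ((hAm 1 1).mul (hgm 1))).mul (hgm 1))
  have hnn : ∀ z : Fin 2 → ℝ, 0 ≤ z ⬝ᵥ z := fun z => by
    simp only [dotProduct, Fin.sum_univ_two]; nlinarith [sq_nonneg (z 0), sq_nonneg (z 1)]
  have hint2 : Integrable (fun x => (A x *ᵥ gradVec Ω φ x) ⬝ᵥ gradVec Ω φ x)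
      (volume.restrict Ω) := by
    refine (hint.const_mul κ').mono' hm ?_
    filter_upwards [ae_restrict_mem hΩ] with x hx
    rw [dotProduct_comm, Real.norm_of_nonneg
      ((mul_nonneg hκ.le (hnn _)).trans (hA1 x hx (gradVec Ω φ x)))]
    exact hA2 x hx _
  refine integral_mono_ae (hint.const_mul κ) hint2 ?_
  filter_upwards [ae_restrict_mem hΩ] with x hx
  rw [dotProduct_comm (A x *ᵥ _)]
  exact hA1 x hx _

end Estimates

/-! ### The scalar recursion and the correction factor -/

section Scalar

/-- The equation is linear in `r'` with a positive coefficient. For the upper bound the term `d / E`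
is dropped, and the two conditions on `M` make it a supersolution for every `Δt`. -/
theorem auxiliary_step {r r' Δt γ E C d F : ℝ} (hΔt : 0 < Δt) (hγ : 0 < γ) (hE : 0 < E)
    (hC : 0 < C) (hd : 0 ≤ d) (hF : 0 ≤ F) (hr : 0 < r)
    (h : (r' - r) / Δt + γ * r' = -(r' / E) * d + F + γ * C) :
    0 < r' ∧ ∀ M, r ≤ M → F + γ * C ≤ γ * M → r' ≤ M := by
  have hγC := mul_pos hγ hC
  have e : r' * (1 / Δt + γ + d / E) = r / Δt + F + γ * C := by
    field_simp at h ⊢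
    linarith
  have hdE : 0 ≤ d / E := by positivity
  have hr' : 0 < r' := by
    have h1 : 0 < r' * (1 / Δt + γ + d / E) := by rw [e]; positivity
    exact pos_of_mul_pos_left h1 (by positivity)
  refine ⟨hr', fun M hM hFM => ?_⟩
  have h2 : r' * (1 / Δt + γ) ≤ M * (1 / Δt + γ) := by
    have h3 : r / Δt ≤ M * (1 / Δt) := by rw [div_eq_mul_one_div]; gcongr
    nlinarith [mul_nonneg hr'.le hdE]
  exact le_of_mul_le_mul_right h2 (by positivity)

/-- The geometric sum in `1 - ξ` extracts the factor `ξ`, which will offset the growth of the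
uncorrected field. -/
theorem abs_one_sub_one_sub_pow_le {ξ M : ℝ} (hξ : 0 ≤ ξ) (hM : ξ ≤ M) (k : ℕ) :
    |1 - (1 - ξ) ^ k| ≤ ξ * (k * (1 + M) ^ k) := by
  have h1 : |1 - ξ| ≤ 1 + M := by rw [abs_le]; constructor <;> linarith
  have hs := mul_neg_geom_sum (1 - ξ) k
  rw [sub_sub_cancel] at hs
  rw [← hs, abs_mul, abs_of_nonneg hξ]
  gcongr
  refine (Finset.abs_sum_le_sum_abs _ _).trans ?_
  calc ∑ i ∈ Finset.range k, |(1 - ξ) ^ i| ≤ ∑ i ∈ Finset.range k, (1 + M) ^ k := by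
        refine Finset.sum_le_sum fun i hi => ?_
        rw [abs_pow]
        calc |1 - ξ| ^ i ≤ (1 + M) ^ i := by gcongr
          _ ≤ (1 + M) ^ k := pow_le_pow_right₀ (by linarith) (Finset.mem_range.1 hi).le
    _ = _ := by simp

/-- One factor `r / (E + C)` compensates `N`, which grows at most like `1 + E ≤ E + C`; the
remaining factor is bounded because `r / (E + C) ≤ M`. -/
theorem scaled_norm_le {r M E C N b : ℝ} {k : ℕ} (hr : 0 < r) (hrM : r ≤ M) (hE : 0 ≤ E)
    (hC : 1 ≤ C) (hN : 0 ≤ N) (hb : N ≤ b * (1 + E)) :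
    |1 - (1 - r / (E + C)) ^ k| * N ≤ b * M * (k * (1 + M) ^ k) := by
  have hEC : 0 < E + C := by linarith
  have hξM : r / (E + C) ≤ M := by
    rw [div_le_iff₀ hEC]
    nlinarith
  have hξ : 0 ≤ r / (E + C) := by positivity
  have hb0 : 0 ≤ b := nonneg_of_mul_nonneg_left (hN.trans hb) (by linarith)
  have hM : 0 ≤ M := hr.le.trans hrM
  have h1 : r / (E + C) * N ≤ b * M := by
    rw [div_mul_eq_mul_div, div_le_iff₀ hEC]
    calc r * N ≤ M * (b * (1 + E)) := by gcongr
      _ ≤ M * (b * (E + C)) := by rw [add_comm E C]; gcongr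
      _ = _ := by ring
  calc |1 - (1 - r / (E + C)) ^ k| * N
      ≤ (r / (E + C) * (k * (1 + M) ^ k)) * N := by
        gcongr
        exact abs_one_sub_one_sub_pow_le hξ hξM k
    _ = (r / (E + C) * N) * (k * (1 + M) ^ k) := by ring
    _ ≤ _ := by gcongr

end Scalar

/-! ### Coercivity of the dissipation -/

namespace Model

variable {J : ℕ} {D : Model J}

theorem slip_self_nonneg (j : Fin J) (hD : D.Admissible) (u : Plane → Plane) :
    0 ≤ D.slip (D.η j) u u := by
  refine integral_nonneg fun x => ?_
  have hη : 0 ≤ D.η j x :=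
    div_nonneg (mul_nonneg (mul_nonneg hD.αBJ_nonneg hD.ν_pos.le) (Real.sqrt_nonneg _))
      (Real.sqrt_nonneg _)
  simp only [Pi.zero_apply, mul_assoc]
  exact mul_nonneg hη (mul_self_nonneg _)

theorem energy_nonneg (hD : D.Admissible) (u : Plane → Plane) (φ : Plane → ℝ) :
    0 ≤ D.energy u φ := by
  have := hD.g_pos
  have := hD.S_pos
  unfold energy
  positivity

theorem l2Norm_le_energy_left (hD : D.Admissible) (u : Plane → Plane) (φ : Plane → ℝ) :
    l2Norm D.Ωf u ≤ 1 * (1 + D.energy u φ) := by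
  have := hD.g_pos
  have := hD.S_pos
  have h : 0 ≤ (1 / 2) * D.g * D.S * l2Norm D.Ωp φ ^ 2 := by positivity
  unfold energy
  nlinarith [sq_nonneg (l2Norm D.Ωf u - 1)]

theorem l2Norm_le_energy_right (hD : D.Admissible) (u : Plane → Plane) (φ : Plane → ℝ) :
    l2Norm D.Ωp φ ≤ (1 + 1 / (D.g * D.S)) * (1 + D.energy u φ) := by
  have hg := hD.g_pos
  have hS := hD.S_pos
  have hgS : 0 < D.g * D.S := by positivity
  set N := l2Norm D.Ωp φ
  have h1 : D.g * D.S / 2 * N ^ 2 ≤ D.energy u φ := by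
    unfold energy
    nlinarith [sq_nonneg (l2Norm D.Ωf u)]
  have h2 : 1 / (D.g * D.S) * (D.g * D.S / 2 * N ^ 2) ≤ 1 / (D.g * D.S) * D.energy u φ := by
    gcongr
  have h3 : 1 / (D.g * D.S) * (D.g * D.S / 2 * N ^ 2) = N ^ 2 / 2 := by field_simp
  have h4 : 0 < 1 / (D.g * D.S) := by positivity
  nlinarith [sq_nonneg (N - 1), energy_nonneg hD u φ]

/-- A nonempty remainder of a boundary after removing a closed set contains a boundary ball. -/
theorem exists_ball_inter_frontier_subset {A B : Set Plane}
    (h : (frontier A \ (frontier A ∩ frontier B)).Nonempty) :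
    ∃ x ∈ frontier A, ∃ ρ > 0,
      Metric.ball x ρ ∩ frontier A ⊆ frontier A \ (frontier A ∩ frontier B) := by
  obtain ⟨x, hxA, hx⟩ := h
  have hxB : x ∈ (frontier B)ᶜ := fun hB => hx ⟨hxA, hB⟩
  obtain ⟨ρ, hρ, hball⟩ := Metric.isOpen_iff.1 isClosed_frontier.isOpen_compl x hxB
  exact ⟨x, hxA, ρ, hρ, fun y hy => ⟨hy.2, fun hy' => hball hy.1 hy'.2⟩⟩

theorem friedrichs_f (hD : D.Admissible) :
    ∃ c > 0, ∀ u, D.MemXf u → c * l2Norm D.Ωf u ^ 2 ≤ gradInner D.Ωf u u := by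
  obtain ⟨x, hx, ρ, hρ, hs⟩ := exists_ball_inter_frontier_subset hD.nonempty_Γf
  exact friedrichs hD.lipschitz_f hx hρ hs

theorem friedrichs_p (hD : D.Admissible) :
    ∃ c > 0, ∀ φ, D.MemXp φ → c * l2Norm D.Ωp φ ^ 2 ≤ gradInner D.Ωp φ φ := by
  have h := hD.nonempty_Γp
  rw [Γp, Γ, Set.inter_comm] at h
  obtain ⟨x, hx, ρ, hρ, hs⟩ := exists_ball_inter_frontier_subset h
  rw [Set.inter_comm (frontier D.Ωp) (frontier D.Ωf)] at hs
  exact friedrichs hD.lipschitz_p hx hρ hs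

/-- The dissipation, stabilized by the forcing terms, controls the energy. -/
theorem exists_dissipation_constants (hD : D.Admissible) (j : Fin J) :
    ∃ α γ : ℝ, 0 < α ∧ 0 < γ ∧ ∀ (u f : Plane → Plane) (φ q : Plane → ℝ),
      D.MemXf u → D.MemXp φ → MemLp f 2 (volume.restrict D.Ωf) →
      MemLp q 2 (volume.restrict D.Ωp) →
      0 ≤ D.ν * gradInner D.Ωf u u + D.g * weightedGradInner D.Ωp (D.K j) φ φ
        + D.slip (D.η j) u u - l2Inner D.Ωf f u - l2Inner D.Ωp q φ
        + α / 2 * (l2Norm D.Ωf f ^ 2 + l2Norm D.Ωp q ^ 2)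
        - γ / 2 * (l2Norm D.Ωf u ^ 2 + D.g * D.S * l2Norm D.Ωp φ ^ 2) := by
  obtain ⟨cf, hcf, hf⟩ := friedrichs_f hD
  obtain ⟨cp, hcp, hp⟩ := friedrichs_p hD
  obtain ⟨κ, κ', hκ, hK⟩ := hD.elliptic_K j
  have hν := hD.ν_pos
  have hg := hD.g_pos
  have hS := hD.S_pos
  have hgS : 0 < D.g * D.S := by positivity
  -- `m` is a common coercivity constant. Young's inequality with parameter `1 / m` costs exactly
  -- the `α` term and `m / 2` of the coercivity; `γ = m / (1 + g * S)` makes both `γ` and `γ * g *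
  -- S` at most `m`, so the other half suffices.
  set m := min (D.ν * cf) (D.g * (κ * cp)) with hm
  have hm0 : 0 < m := lt_min (by positivity) (by positivity)
  refine ⟨1 / m, m / (1 + D.g * D.S), by positivity, by positivity,
    fun u f φ q hu hφ hfm hqm => ?_⟩
  have h1 := l2Inner_le hfm hu.1.1 (a := 1 / m) (by positivity)
  have h2 := l2Inner_le hqm hφ.1.1 (a := 1 / m) (by positivity)
  have h3 := slip_self_nonneg j hD u
  have h4 := hf u hu
  have h5 := hp φ hφ
  have h6 := mul_gradInner_le_weighted (κ' := κ') hD.lipschitz_p.isOpen.measurableSet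
    (hD.measurable_K j) hκ (fun x hx z => (hK x (Or.inl hx) z).1)
    (fun x hx z => (hK x (Or.inl hx) z).2) hφ.1
  have e1 : 1 / (2 * (1 / m)) = m / 2 := by field_simp
  rw [e1] at h1 h2
  set U := l2Norm D.Ωf u ^ 2
  set P := l2Norm D.Ωp φ ^ 2
  have hU : 0 ≤ U := sq_nonneg _
  have hP : 0 ≤ P := sq_nonneg _
  have h7 : m * U ≤ D.ν * gradInner D.Ωf u u :=
    calc m * U ≤ D.ν * cf * U := by gcongr; exact min_le_left _ _
      _ = D.ν * (cf * U) := by ring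
      _ ≤ _ := by gcongr
  have h8 : m * P ≤ D.g * weightedGradInner D.Ωp (D.K j) φ φ :=
    calc m * P ≤ D.g * (κ * cp) * P := by gcongr; exact min_le_right _ _
      _ = D.g * (κ * (cp * P)) := by ring
      _ ≤ D.g * (κ * gradInner D.Ωp φ φ) := by gcongr
      _ ≤ _ := by gcongr
  have h9 : m / (1 + D.g * D.S) / 2 * (U + D.g * D.S * P) ≤ m / 2 * U + m / 2 * P := by
    have e2 : m / 2 * U + m / 2 * P - m / (1 + D.g * D.S) / 2 * (U + D.g * D.S * P) =
        m / (1 + D.g * D.S) / 2 * (D.g * D.S * U + P) := by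
      field_simp
      ring
    have : 0 ≤ m / (1 + D.g * D.S) / 2 * (D.g * D.S * U + P) := by positivity
    linarith
  linarith

end Model

end NSD

/-! ### Uniform bounds for the scheme -/

theorem theorem3p1 {J : ℕ} (D : NSD.Model J) (hD : D.Admissible) :
    ∃ α γ : Fin J → ℝ, (∀ j, 0 < α j) ∧ (∀ j, 0 < γ j) ∧
      ∀ (k : ℕ), 2 ≤ k → k ≤ 4 →
      ∀ (Cf : ℝ), 0 < Cf → ∀ (Cr : Fin J → ℝ), (∀ j, 1 ≤ Cr j) → ∀ (R : ℝ),
      ∃ M : ℝ, 0 < M ∧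
        ∀ (β : ℝ), 1 < β → ∀ (Δt : ℝ), 0 < Δt → ∀ (T : ℝ),
        ∀ (f : NSD.Forcing J), f.BoundedBy D Cf →
        ∀ (X : NSD.Trajectory J), X.IsSchemeSolution D f k β Δt Cr α γ T →
        ∀ j : Fin J,
          (∀ n : ℕ, k ≤ n + 1 → (n : ℝ) + 1 ≤ T / Δt → 0 < X.r j n →
            0 < X.r j (n + 1) ∧ 0 < X.ξ j (n + 1)) ∧
          (0 < X.r j (k - 1) → X.r j (k - 1) ≤ R →
            ∀ n : ℕ, k ≤ n + 1 → (n : ℝ) + 1 ≤ T / Δt →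
              0 < X.r j (n + 1) ∧ 0 < X.ξ j (n + 1) ∧
              NSD.l2Norm D.Ωf (X.u j (n + 1)) ≤ M ∧
              NSD.l2Norm D.Ωp (X.φ j (n + 1)) ≤ M) := by
  choose α γ hα hγ hdiss using NSD.Model.exists_dissipation_constants hD
  refine ⟨α, γ, hα, hγ, fun k hk2 _ Cf _ Cr hCr R => ?_⟩
  have hg := hD.g_pos
  have hgS : 0 < D.g * D.S := mul_pos hg hD.S_pos
  set Φ : Fin J → ℝ := fun j => α j / 2 * (Cf ^ 2 + (D.g * Cf) ^ 2) with hΦ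
  have hΦ0 : ∀ j, 0 ≤ Φ j := fun j => by have := hα j; positivity
  -- The invariant upper bound for `r`: it dominates the starting value through `|R|` and satisfies
  -- `Φ j + γ j * Cr j ≤ γ j * N j`.
  set N : Fin J → ℝ := fun j => |R| + Φ j / γ j + Cr j with hN
  have hN0 : ∀ j, 0 < N j := fun j => by
    have := hγ j
    have := hΦ0 j
    have : 0 < Cr j := by linarith [hCr j]
    positivity
  set b : ℝ := 1 + 1 / (D.g * D.S) with hb
  have hb1 : 1 ≤ b := by
    have : 0 < 1 / (D.g * D.S) := by positivity
    linarith
  set B : Fin J → ℝ := fun j => b * N j * ((k + 1 : ℕ) * (1 + N j) ^ (k + 1)) with hB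
  have hB0 : ∀ j, 0 ≤ B j := fun j => by have := hN0 j; positivity
  -- The sum serves all members at once; the added 1 keeps the constant positive even for an empty
  -- ensemble.
  refine ⟨1 + ∑ j, B j, by linarith [Finset.sum_nonneg fun j (_ : j ∈ Finset.univ) => hB0 j],
    fun β _ Δt hΔt T f hf X hX j => ?_⟩
  have hBM : B j ≤ 1 + ∑ j, B j := by
    have := Finset.single_le_sum (fun j _ => hB0 j) (Finset.mem_univ j)
    linarith
  have hCr0 : 0 < Cr j := by linarith [hCr j]
  have hstep : ∀ n : ℕ, k ≤ n + 1 → (n : ℝ) + 1 ≤ T / Δt → 0 < X.r j n →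
      0 < X.r j (n + 1) ∧ (X.r j n ≤ N j → X.r j (n + 1) ≤ N j) := by
    intro n hkn hnT hr
    obtain ⟨⟨hu, -, -, hφ, -⟩, -, -, -, haux, -⟩ := hX.step j n hkn hnT
    obtain ⟨hf1, hf2, hf3, hf4⟩ := hf j (((n + 1 : ℕ) : ℝ) * Δt) (by positivity)
    have hd := hdiss j _ _ _ _ hu hφ hf1 (hf3.const_smul D.g)
    have hE := NSD.Model.energy_nonneg hD (X.ubar j (n + 1)) (X.φbar j (n + 1))
    have hF0 : 0 ≤ NSD.Trajectory.forceTerm D f Δt α j (n + 1) := by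
      have := hα j
      unfold NSD.Trajectory.forceTerm
      positivity
    have hFΦ : NSD.Trajectory.forceTerm D f Δt α j (n + 1) ≤ Φ j := by
      have := hα j
      have h0 := NSD.l2Norm_nonneg (Ω := D.Ωf) (f.ff j (((n + 1 : ℕ) : ℝ) * Δt))
      have h0' := NSD.l2Norm_nonneg (Ω := D.Ωp) (f.fp j (((n + 1 : ℕ) : ℝ) * Δt))
      unfold NSD.Trajectory.forceTerm
      rw [NSD.l2Norm_smul, abs_of_pos hg]
      simp only [hΦ]
      gcongr
    obtain ⟨h1, h2⟩ := NSD.auxiliary_step hΔt (hγ j) (by linarith) hCr0 hd hF0 hr haux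
    refine ⟨h1, fun h => h2 _ h ?_⟩
    have hγj := hγ j
    have : γ j * N j = γ j * |R| + Φ j + γ j * Cr j := by simp only [hN]; field_simp
    have : 0 ≤ γ j * |R| := by positivity
    linarith
  have hξ : ∀ n : ℕ, k ≤ n + 1 → (n : ℝ) + 1 ≤ T / Δt → 0 < X.r j (n + 1) →
      0 < X.ξ j (n + 1) := by
    intro n hkn hnT hr
    rw [(hX.step j n hkn hnT).2.2.2.2.2.1]
    have hE := NSD.Model.energy_nonneg hD (X.ubar j (n + 1)) (X.φbar j (n + 1))
    positivity
  refine ⟨fun n hkn hnT hr => ⟨(hstep n hkn hnT hr).1, hξ n hkn hnT (hstep n hkn hnT hr).1⟩,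
    fun hr0 hrR => ?_⟩
  -- Level `k - 1` is a starting value, bounded through `R`, and is admitted whatever the final
  -- time; the first level given by the equation is `k`.
  have hall : ∀ n : ℕ, k - 1 ≤ n → (n : ℝ) ≤ T / Δt ∨ n = k - 1 →
      0 < X.r j n ∧ X.r j n ≤ N j := by
    intro n hn
    induction n, hn using Nat.le_induction with
    | base =>
      refine fun _ => ⟨hr0, hrR.trans ?_⟩
      have := hγ j
      have := hΦ0 j
      have h1 : 0 ≤ Φ j / γ j := by positivity
      simp only [hN]
      linarith [le_abs_self R]
    | succ n hn ih =>
      rintro (hT | h)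
      · push_cast at hT
        obtain ⟨h1, h2⟩ := ih (Or.inl (by linarith))
        obtain ⟨h3, h4⟩ := hstep n (by omega) hT h1
        exact ⟨h3, h4 h2⟩
      · omega
  intro n hkn hnT
  obtain ⟨hr, hrN⟩ := hall (n + 1) (by omega) (Or.inl (by push_cast; exact hnT))
  refine ⟨hr, hξ n hkn hnT hr, ?_⟩
  obtain ⟨-, -, -, -, -, hξe, hue, hφe⟩ := hX.step j n hkn hnT
  have hE := NSD.Model.energy_nonneg hD (X.ubar j (n + 1)) (X.φbar j (n + 1))
  constructor
  · rw [NSD.l2Norm_congr hue, NSD.l2Norm_smul, NSD.Trajectory.scaling, hξe]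
    refine (NSD.scaled_norm_le hr hrN hE (hCr j) (NSD.l2Norm_nonneg _) ?_).trans hBM
    refine (NSD.Model.l2Norm_le_energy_left hD _ (X.φbar j (n + 1))).trans ?_
    gcongr
  · rw [NSD.l2Norm_congr hφe, NSD.l2Norm_smul, NSD.Trajectory.scaling, hξe]
    exact (NSD.scaled_norm_le hr hrN hE (hCr j) (NSD.l2Norm_nonneg _)
      (NSD.Model.l2Norm_le_energy_right hD _ _)).trans hBM
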